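/- **Setting.** Let $A_i\in\mathbb R^{d\times d}$, $B_i\in\mathbb R^{d\times k}$, $Q_i\in\mathbb R^{d\times d}$, $R_i\in\mathbb R^{k\times k}$ for $i\in\{1,\dots,N\}$, with all $Q_i$ and $R_i$ symmetric positive definite. Let $(\omega(t))_{t\ge 0}$ be a time-homogeneous Markov chain on $\{1,\dots,N\}$ with transition probabilities $p_{ij}$ and initial distribution $\pi$, $\pi_i>0$ for all $i$, and let $x_0$ be a square-integrable random vector in $\mathbb R^d$, independent of the chain, with $\Sigma_0=\mathbb E[x_0x_0^T]\succ0$. For a tuple $K=(K_1,\dots,K_N)$ of matrices in $\mathbb R^{k\times d}$ consider $x_{t+1}=A_{\omega(t)}x_t+B_{\omega(t)}u_t$ with $u_t=-K_{\omega(t)}x_t$, and $$C(K)=\mathbb E\Big[\sum_{t=0}^\infty x_t^TQ_{\omega(t)}x_t+u_t^TR_{\omega(t)}u_t\Big].$$ Let $\mathbb K$ be the set of those $K$ for which the closed loop is mean-square stable, that is, $\mathbb E[x_tx_t^T]\to0$ for every deterministic initial state and every initial mode $\omega(0)$; assume $\mathbb K\neq\emptyset$. For $K\in\mathbb K$ let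 $\mathbf X^K=(\mathbf X^K_1,\dots,\mathbf X^K_N)$ with $\mathbf X^K_i=\sum_{t\ge0}\mathbb E[x_tx_t^T\mathbf 1_{\omega(t)=i}]$. Gradients are taken with respect to $\langle V,S\rangle=\sum_i\operatorname{tr}(V_i^TS_i)$. For a tuple $V$ let $\|V\|_{\max}=\max_i\|V_i\|$ (largest singular value) and $\Lambda_{\min}(V)=\min_i\sigma_{\min}(V_i)$ (smallest singular value). Put $\mathcal E_i(V)=\sum_jp_{ij}V_j$, $\mu=\min_i\pi_i\,\sigma_{\min}(\Sigma_0)$ and, for $\alpha\in\mathbb R$, $$\xi_\alpha=\frac1{\Lambda_{\min}(Q)}\Big(\frac{1+\|B\|_{\max}^2}{\mu}\alpha+\|R\|_{\max}\Big)-1,\qquad L_\alpha=2\Big(\|R\|_{\max}+\big(\|B\|_{\max}^2+2\xi_\alpha\|B\|_{\max}\big)\frac\alpha\mu\Big)\frac{\alpha}{\Lambda_{\min}(Q)}.$$ **Theorem (global convergence of policy gradient).** The coupled Riccati equations $$P_i=Q_i+A_i^T\mathcal E_i(P)A_i-A_i^T\mathcal E_i(P)B_i\big(R_i+B_i^T\mathcal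 E_i(P)B_i\big)^{-1}B_i^T\mathcal E_i(P)A_i\qquad(1\le i\le N)$$ have a unique solution $P=(P_1,\dots,P_N)$ with all $P_i$ positive definite. The gain $K^*_i=(R_i+B_i^T\mathcal E_i(P)B_i)^{-1}B_i^T\mathcal E_i(P)A_i$ lies in $\mathbb K$ and minimizes $C$ over $\mathbb K$, $C(K^*)<\infty$, and the series defining $\mathbf X^{K^*}$ converges. Let $K^0\in\mathbb K$, $\alpha=C(K^0)$ and $L=L_\alpha$. For every step size $0<\eta\le 1/L$ the gradient descent iterates $K^{n+1}=K^n-\eta\nabla C(K^n)$ all stay in $\mathbb K$ (and $C$ is finite and differentiable at each of them), they converge to $K^*$, and for all $n\ge0$ $$C(K^n)-C(K^*)\le\Big(1-\frac{2\mu^2\Lambda_{\min}(R)}{\|\mathbf X^{K^*}\|_{\max}}\,\eta\Big)^n\big(C(K^0)-C(K^*)\big).$$ -/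

import Mathlib

open MeasureTheory ProbabilityTheory Filter Topology
open scoped Matrix ENNReal

noncomputable section

/-- `N`-tuples of real `m × n` matrices. -/
abbrev MatTuple (N m n : ℕ) : Type := Fin N → Matrix (Fin m) (Fin n) ℝ

/-- The maximal singular value, i.e. the operator norm for the Euclidean norms. -/
def specNorm {m n : ℕ} (M : Matrix (Fin m) (Fin n) ℝ) : ℝ :=
  ‖(Matrix.toEuclideanLin M).toContinuousLinearMap‖

/-- The minimal singular value of a square matrix (the singular values are listed in
decreasing order, with indices `0, …, n - 1`). -/
def sigmaMin {n : ℕ} (M : Matrix (Fin n) (Fin n) ℝ) : ℝ :=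
  (Matrix.toEuclideanLin M).singularValues (n - 1)

/-- `‖V‖_max`, the largest spectral norm of a member of the tuple. -/
def maxNorm {N m n : ℕ} (V : MatTuple N m n) : ℝ := ⨆ i, specNorm (V i)

/-- `Λ_min(V)`, the smallest singular value of all members of the tuple. -/
def lambdaMin {N n : ℕ} (V : MatTuple N n n) : ℝ := ⨅ i, sigmaMin (V i)

/-- The matrix `𝔼[x xᵀ]` of second moments of a random vector. -/
def secondMoment {W : Type*} [MeasurableSpace W] {d : ℕ} (Pr : Measure W)
    (x : W → Fin d → ℝ) : Matrix (Fin d) (Fin d) ℝ :=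
  Matrix.of fun a b => ∫ w, x w a * x w b ∂Pr

/-- The data of a Markovian jump linear quadratic control problem with `N` modes, state
dimension `d` and control dimension `k`: system matrices, cost matrices, transition
probabilities and initial distribution of the mode. -/
structure MJLS (N d k : ℕ) where
  A : MatTuple N d d
  B : MatTuple N d k
  Q : MatTuple N d d
  R : MatTuple N k k
  p : Matrix (Fin N) (Fin N) ℝ
  init : Fin N → ℝ

namespace MJLS

variable {N d k : ℕ} (S : MJLS N d k)

/-- The state `x_t` driven by the mode sequence `s` from the initial state `v`, under the
feedback `u_t = -K_{s(t)} x_t`:  `x_{t+1} = A_{s(t)} x_t + B_{s(t)} u_t`. -/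
def state (K : MatTuple N k d) (s : ℕ → Fin N) (v : Fin d → ℝ) : ℕ → Fin d → ℝ
  | 0 => v
  | t + 1 => S.A (s t) *ᵥ state K s v t + S.B (s t) *ᵥ (-(K (s t) *ᵥ state K s v t))

/-- The control `u_t = -K_{s(t)} x_t`. -/
def control (K : MatTuple N k d) (s : ℕ → Fin N) (v : Fin d → ℝ) (t : ℕ) : Fin k → ℝ :=
  -(K (s t) *ᵥ S.state K s v t)

/-- The stage cost `x_tᵀ Q_{s(t)} x_t + u_tᵀ R_{s(t)} u_t`. -/
def stageCost (K : MatTuple N k d) (s : ℕ → Fin N) (v : Fin d → ℝ) (t : ℕ) : ℝ :=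
  S.state K s v t ⬝ᵥ (S.Q (s t) *ᵥ S.state K s v t)
    + S.control K s v t ⬝ᵥ (S.R (s t) *ᵥ S.control K s v t)

/-- `ℰ_i(V) = ∑_j p_{ij} V_j`. -/
def E (V : MatTuple N d d) : MatTuple N d d := fun i => ∑ j, S.p i j • V j

/-- `P` is a positive definite solution of the coupled algebraic Riccati equations. -/
def IsRiccatiSolution (P : MatTuple N d d) : Prop :=
  (∀ i, (P i).PosDef) ∧
  ∀ i, P i = S.Q i + (S.A i)ᵀ * S.E P i * S.A i
    - (S.A i)ᵀ * S.E P i * S.B i * (S.R i + (S.B i)ᵀ * S.E P i * S.B i)⁻¹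
        * (S.B i)ᵀ * S.E P i * S.A i

/-- The feedback gain `(R + Bᵀ ℰ(P) B)⁻¹ Bᵀ ℰ(P) A`. -/
def riccatiGain (P : MatTuple N d d) : MatTuple N k d := fun i =>
  (S.R i + (S.B i)ᵀ * S.E P i * S.B i)⁻¹ * (S.B i)ᵀ * S.E P i * S.A i

section Probability

variable {W : Type*} [MeasurableSpace W] (Pr : Measure W)
  (x0 : W → Fin d → ℝ) (ω : ℕ → W → Fin N)

/-- The random initial state `x0` is square integrable, the mode process `ω` is a
time-homogeneous Markov chain with transition matrix `p` and initial distribution `init`,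
and `x0` is independent of `ω`.  The Markov property is written without division:
`Pr(ω_{t+1} = j, ω_0 = s_0, …, ω_t = s_t) = p_{s_t j} Pr(ω_0 = s_0, …, ω_t = s_t)`. -/
structure IsRealization : Prop where
  measurable_x0 : Measurable x0
  memLp_x0 : MemLp x0 2 Pr
  measurable_mode : ∀ t, Measurable (ω t)
  init_law : ∀ i, Pr.real {w | ω 0 w = i} = S.init i
  markov : ∀ (t : ℕ) (s : ℕ → Fin N) (j : Fin N),
    Pr.real {w | (∀ r ≤ t, ω r w = s r) ∧ ω (t + 1) w = j}
      = S.p (s t) j * Pr.real {w | ∀ r ≤ t, ω r w = s r}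
  indep : IndepFun x0 (fun w t => ω t w) Pr

/-- The set `𝕂` of gains for which the closed loop is mean-square stable: `𝔼[x_t x_tᵀ] → 0`
for every deterministic initial state `v` and every initial mode `i`, the expectation being
that of the chain started at `i`, i.e. conditional on `ω(0) = i`. -/
def stabilizing : Set (MatTuple N k d) :=
  {K | ∀ (v : Fin d → ℝ) (i : Fin N),
    Tendsto (fun t => secondMoment (Pr[|{w | ω 0 w = i}])
      (fun w => S.state K (fun r => ω r w) v t)) atTop (𝓝 0)}

/-- The cost `𝔼[∑_t x_tᵀ Q x_t + u_tᵀ R u_t]`, with values in `[0, ∞]`. -/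
def extCost (K : MatTuple N k d) : ℝ≥0∞ :=
  ∫⁻ w, ∑' t, ENNReal.ofReal (S.stageCost K (fun r => ω r w) (x0 w) t) ∂Pr

/-- The cost `C(K)` as a real number, meaningful where `extCost` is finite. -/
def cost (K : MatTuple N k d) : ℝ := (S.extCost Pr x0 ω K).toReal

/-- The gradient `∇C(K)` for the inner product `⟨V, S⟩ = ∑_i tr(V_iᵀ S_i)`: the `(a, b)` entry
of its `i`-th member is the derivative of `C` in the direction of the `(a, b)` entry of `K_i`. -/
def gradCost (K : MatTuple N k d) : MatTuple N k d := fun i =>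
  Matrix.of fun a b => fderiv ℝ (S.cost Pr x0 ω) K (Pi.single i (Matrix.single a b 1))

/-- `X_i(t) = 𝔼[x_t x_tᵀ 1_{ω(t) = i}]`. -/
def modeCov (K : MatTuple N k d) (t : ℕ) : MatTuple N d d := fun i =>
  secondMoment (Pr.restrict {w | ω t w = i}) (fun w => S.state K (fun r => ω r w) (x0 w) t)

/-- `𝐗^K = ∑_t X(t)`. -/
def sumCov (K : MatTuple N k d) : MatTuple N d d := ∑' t, S.modeCov Pr x0 ω K t

/-- `μ = min_i π_i · σ_min(𝔼[x_0 x_0ᵀ])`. -/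
def mu : ℝ := (⨅ i, S.init i) * sigmaMin (secondMoment Pr x0)

/-- The constant `ξ` at level `α`. -/
def xi (α : ℝ) : ℝ :=
  1 / lambdaMin S.Q * ((1 + maxNorm S.B ^ 2) / S.mu Pr x0 * α + maxNorm S.R) - 1

/-- The smoothness constant `L` of the sublevel set at level `α`:
`2 (‖R‖ + ‖B‖² (1 + 2 ξ / ‖B‖) α / μ) α / Λ_min(Q)`, with `‖B‖² (1 + 2 ξ / ‖B‖)` read as
`‖B‖² + 2 ξ ‖B‖`. -/
def smoothConst (α : ℝ) : ℝ :=
  2 * (maxNorm S.R + (maxNorm S.B ^ 2 + 2 * S.xi Pr x0 α * maxNorm S.B) * (α / S.mu Pr x0))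
    * (α / lambdaMin S.Q)

/-- The gradient descent iterates `K^{n+1} = K^n - η ∇C(K^n)`. -/
def gdIter (η : ℝ) (K0 : MatTuple N k d) : ℕ → MatTuple N k d
  | 0 => K0
  | n + 1 => gdIter η K0 n - η • S.gradCost Pr x0 ω (gdIter η K0 n)

end Probability

end MJLS

end

/-!
In the Loewner order on tuples of matrices the closed loop acts by a monotone operator `forward K`
on mode-wise second moments, with adjoint `backward K` for the trace pairing.  A gain is mean-square
stable exactly when `P - backward K P` is uniformly positive for some `P ≥ 0`, and then the cost
is the pairing of the initial second moments with `value K`, the solution of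
`P = runningCost K + backward K P`.

The argument rests on the exact identity for the change of `value` between two stable gains.
It splits into a linear term in `gainResidual`, which gives the gradient of the cost, and a
nonnegative quadratic term.  Hence a stable gain with zero residual, that is a Riccati gain, is
a global minimizer, and completing the square turns the same identity into the gradient domination
inequality `cost K - cost K* ≤ const * ‖gradient‖²`.  Sublevel sets of the cost are compact, so a
minimizer exists; on them the second-order remainder is at most `L / 2 * ‖K' - K‖²`.  When
`η ≤ 1 / L` the gradient step stays in the sublevel set: the cost decreases strictly along the
segment up to time `η`, so the segment cannot reach the boundary.  Descent and gradient domination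
together give the linear rate, and the quadratic term in the identity turns convergence of the costs
into convergence of the gains.
-/

noncomputable section

open Matrix
open scoped MatrixOrder

namespace LoewnerOrder

section QuadraticForms

variable {l m n : Type*} [Finite m] [Fintype n]

theorem nonneg_iff_dotProduct_mulVec {A : Matrix n n ℝ} :
    0 ≤ A ↔ Aᵀ = A ∧ ∀ v, 0 ≤ v ⬝ᵥ (A *ᵥ v) := by
  rw [nonneg_iff_posSemidef, posSemidef_iff_dotProduct_mulVec, IsHermitian,
    conjTranspose_eq_transpose_of_trivial]
  simp only [star_trivial]

theorem transpose_eq_of_nonneg {A : Matrix l l ℝ} (hA : 0 ≤ A) : Aᵀ = A := by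
  rw [← conjTranspose_eq_transpose_of_trivial]
  exact (nonneg_iff_posSemidef.1 hA).1

theorem trace_nonneg {A : Matrix n n ℝ} (hA : 0 ≤ A) : 0 ≤ A.trace :=
  (nonneg_iff_posSemidef.1 hA).trace_nonneg

theorem dotProduct_mulVec_mono {A B : Matrix n n ℝ} (h : A ≤ B) (v : n → ℝ) :
    v ⬝ᵥ (A *ᵥ v) ≤ v ⬝ᵥ (B *ᵥ v) := by
  have hv := (nonneg_iff_dotProduct_mulVec.1 (sub_nonneg.2 h)).2 v
  rwa [sub_mulVec, dotProduct_sub, sub_nonneg] at hv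

theorem le_of_dotProduct_mulVec_le {A B : Matrix n n ℝ} (hA : Aᵀ = A) (hB : Bᵀ = B)
    (h : ∀ v, v ⬝ᵥ (A *ᵥ v) ≤ v ⬝ᵥ (B *ᵥ v)) : A ≤ B := by
  refine sub_nonneg.1 (nonneg_iff_dotProduct_mulVec.2 ⟨by rw [transpose_sub, hA, hB], fun v => ?_⟩)
  rw [sub_mulVec, dotProduct_sub, sub_nonneg]
  exact h v

theorem transpose_mul_mul_nonneg {A : Matrix n n ℝ} (hA : 0 ≤ A) (C : Matrix n m ℝ) :
    0 ≤ Cᵀ * A * C := by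
  rw [← conjTranspose_eq_transpose_of_trivial]
  exact ((nonneg_iff_posSemidef.1 hA).conjTranspose_mul_mul_same C).nonneg

theorem mul_mul_transpose_nonneg {A : Matrix n n ℝ} (hA : 0 ≤ A) (C : Matrix m n ℝ) :
    0 ≤ C * A * Cᵀ := by
  simpa only [transpose_transpose] using transpose_mul_mul_nonneg hA Cᵀ

theorem transpose_mul_self_nonneg (C : Matrix n m ℝ) : 0 ≤ Cᵀ * C := by
  rw [← conjTranspose_eq_transpose_of_trivial]
  exact (posSemidef_conjTranspose_mul_self C).nonneg

theorem transpose_mul_mul_mono {A B : Matrix n n ℝ} (h : A ≤ B) (C : Matrix n m ℝ) :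
    Cᵀ * A * C ≤ Cᵀ * B * C := by
  rw [← sub_nonneg] at h ⊢
  simpa only [Matrix.mul_sub, Matrix.sub_mul] using transpose_mul_mul_nonneg h C

theorem transpose_mul_self_le_smul [DecidableEq n] {A : Matrix n n ℝ} {c : ℝ} (h : A ≤ c • 1)
    (C : Matrix n m ℝ) : Cᵀ * A * C ≤ c • (Cᵀ * C) := by
  simpa only [Matrix.mul_smul, Matrix.smul_mul, Matrix.mul_one] using transpose_mul_mul_mono h C

theorem exists_eq_transpose_mul_self {A : Matrix n n ℝ} (hA : 0 ≤ A) :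
    ∃ C : Matrix n n ℝ, A = Cᵀ * C := by
  classical
  obtain ⟨C, hC⟩ := CStarAlgebra.nonneg_iff_eq_star_mul_self.mp hA
  exact ⟨C, by rw [hC, star_eq_conjTranspose, conjTranspose_eq_transpose_of_trivial]⟩

theorem trace_mul_nonneg {A B : Matrix n n ℝ} (hA : 0 ≤ A) (hB : 0 ≤ B) :
    0 ≤ (A * B).trace := by
  obtain ⟨C, rfl⟩ := exists_eq_transpose_mul_self hA
  rw [Matrix.mul_assoc, trace_mul_comm]
  exact trace_nonneg (mul_mul_transpose_nonneg hB C)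

theorem trace_mul_mono_right {A B C : Matrix n n ℝ} (hA : 0 ≤ A) (h : B ≤ C) :
    (A * B).trace ≤ (A * C).trace := by
  have := trace_mul_nonneg hA (sub_nonneg.2 h)
  rwa [Matrix.mul_sub, trace_sub, sub_nonneg] at this

theorem dotProduct_transpose_mul_self_mulVec [Fintype l] (C : Matrix l n ℝ) (v : n → ℝ) :
    v ⬝ᵥ ((Cᵀ * C) *ᵥ v) = (C *ᵥ v) ⬝ᵥ (C *ᵥ v) := by
  rw [← mulVec_mulVec, dotProduct_mulVec, vecMul_transpose]

theorem abs_apply_le_trace {A : Matrix n n ℝ} (hA : 0 ≤ A) (a b : n) : |A a b| ≤ A.trace := by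
  obtain ⟨C, rfl⟩ := exists_eq_transpose_mul_self hA
  have htrace : (Cᵀ * C).trace = ∑ j, ∑ i, C i j ^ 2 := by
    simp [trace, mul_apply, sq]
  have hcol (j : n) : ∑ i, C i j ^ 2 ≤ (Cᵀ * C).trace := by
    rw [htrace]
    exact Finset.single_le_sum (f := fun j => ∑ i, C i j ^ 2)
      (fun j _ => by positivity) (Finset.mem_univ j)
  refine abs_le_of_sq_le_sq ?_ (trace_nonneg hA)
  calc (Cᵀ * C) a b ^ 2 = (∑ i, C i a * C i b) ^ 2 := by simp only [mul_apply, transpose_apply]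
    _ ≤ (∑ i, C i a ^ 2) * ∑ i, C i b ^ 2 := Finset.sum_mul_sq_le_sq_mul_sq _ _ _
    _ ≤ (Cᵀ * C).trace * (Cᵀ * C).trace :=
        mul_le_mul (hcol a) (hcol b) (by positivity) (trace_nonneg hA)
    _ = (Cᵀ * C).trace ^ 2 := (sq _).symm

theorem le_trace_smul_one [DecidableEq n] {A : Matrix n n ℝ} (hA : 0 ≤ A) :
    A ≤ A.trace • (1 : Matrix n n ℝ) := by
  have hpsd := nonneg_iff_posSemidef.1 hA
  rw [← Algebra.algebraMap_eq_smul_one, le_algebraMap_iff_spectrum_le (a := A) hpsd.1,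
    hpsd.1.spectrum_real_eq_range_eigenvalues, hpsd.1.trace_eq_sum_eigenvalues]
  rintro _ ⟨i, rfl⟩
  exact Finset.single_le_sum (fun j _ => hpsd.eigenvalues_nonneg j) (Finset.mem_univ i)

theorem young_of_nonneg {G : Matrix n n ℝ} (hG : 0 ≤ G) (U V : Matrix n m ℝ) {w : ℝ}
    (hw : 0 < w) : Uᵀ * G * V + Vᵀ * G * U ≤ w • (Uᵀ * G * U) + w⁻¹ • (Vᵀ * G * V) := by
  have := Fintype.ofFinite m
  have hsquare := smul_nonneg (inv_nonneg.2 hw.le) (transpose_mul_mul_nonneg hG (w • U - V))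
  have hexpand : w⁻¹ • ((w • U - V)ᵀ * G * (w • U - V))
      = w • (Uᵀ * G * U) + w⁻¹ • (Vᵀ * G * V) - (Uᵀ * G * V + Vᵀ * G * U) := by
    simp only [transpose_sub, transpose_smul, Matrix.sub_mul, Matrix.mul_sub, Matrix.smul_mul,
      Matrix.mul_smul]
    match_scalars <;> field_simp
  rwa [hexpand, sub_nonneg] at hsquare

/- Adding `(w U + V)ᵀ (c - G) (w U + V) ≥ 0` and `(w U - V)ᵀ (c + G) (w U - V) ≥ 0` leaves only
the cross terms of `G` and the diagonal terms of `c`. -/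
theorem young_of_neg_le_of_le [DecidableEq n] {G : Matrix n n ℝ} {c : ℝ} (hneg : -G ≤ c • 1)
    (hle : G ≤ c • 1) (U V : Matrix n m ℝ) {w : ℝ} (hw : 0 < w) :
    Uᵀ * G * V + Vᵀ * G * U ≤ c • (w • (Uᵀ * U) + w⁻¹ • (Vᵀ * V)) := by
  have := Fintype.ofFinite m
  have hplus := transpose_mul_mul_mono hle (w • U + V)
  have hminus := transpose_mul_mul_mono hneg (w • U - V)
  have hsum := smul_le_smul_of_nonneg_left (add_le_add hplus hminus)
    (by positivity : (0 : ℝ) ≤ w⁻¹ * 2⁻¹)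
  rw [← sub_nonneg] at hsum ⊢
  convert hsum using 1
  simp only [transpose_sub, transpose_add, transpose_smul, Matrix.sub_mul, Matrix.mul_sub,
    Matrix.smul_mul, Matrix.add_mul, Matrix.mul_add, Matrix.mul_smul, Matrix.mul_one,
    Matrix.mul_neg, Matrix.neg_mul]
  match_scalars <;> field_simp <;> ring

theorem sq_smul_one_le_mul_transpose [DecidableEq n] {X : Matrix n n ℝ} {c : ℝ} (hc : 0 ≤ c)
    (hX : c • 1 ≤ X) : c ^ 2 • (1 : Matrix n n ℝ) ≤ X * Xᵀ := by
  obtain ⟨Y, rfl⟩ : ∃ Y, X = Y + c • 1 := ⟨X - c • 1, (sub_add_cancel _ _).symm⟩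
  have hY : 0 ≤ Y := by simpa only [le_add_iff_nonneg_left] using hX
  have hYY : 0 ≤ Y * Yᵀ := by simpa only [transpose_transpose] using transpose_mul_self_nonneg Yᵀ
  have hcY : 0 ≤ (2 * c) • Y := smul_nonneg (by positivity) hY
  rw [← sub_nonneg]
  refine (add_nonneg hYY hcY).trans_eq ?_
  rw [transpose_add, transpose_eq_of_nonneg hY]
  simp only [transpose_smul, transpose_one, Matrix.add_mul, Matrix.mul_add, Matrix.mul_smul,
    Matrix.smul_mul, Matrix.mul_one, Matrix.one_mul]
  module

theorem isClosed_setOf_nonneg : IsClosed {A : Matrix m m ℝ | 0 ≤ A} := by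
  have := Fintype.ofFinite m
  simp only [nonneg_iff_dotProduct_mulVec, Set.ofPred_and, Set.ofPred_forall]
  refine IsClosed.inter (isClosed_eq (by fun_prop) continuous_id) (isClosed_iInter fun v => ?_)
  exact isClosed_le continuous_const (by fun_prop)

instance orderClosedTopology : OrderClosedTopology (Matrix m m ℝ) where
  isClosed_le' := by
    have hpreimage : {p : Matrix m m ℝ × Matrix m m ℝ | p.1 ≤ p.2}
        = (fun p => p.2 - p.1) ⁻¹' {A | 0 ≤ A} := by
      ext p
      simp only [Set.mem_ofPred_eq, Set.mem_preimage, sub_nonneg]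
    rw [hpreimage]
    exact isClosed_setOf_nonneg.preimage (by fun_prop)

end QuadraticForms

section SingularValues

variable {m n : ℕ}

theorem sigmaMin_of_zero_dim (M : Matrix (Fin 0) (Fin 0) ℝ) : sigmaMin M = 0 :=
  LinearMap.singularValues_of_finrank_le _ (by simp)

theorem sigmaMin_pos (hn : 0 < n) {M : Matrix (Fin n) (Fin n) ℝ} (hM : M.PosDef) :
    0 < sigmaMin M := by
  have hinj : Function.Injective (toEuclideanLin M) := fun x y hxy => by
    have hMxy : M *ᵥ x.ofLp = M *ᵥ y.ofLp := by simpa using congrArg WithLp.ofLp hxy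
    exact WithLp.ofLp_injective 2 (mulVec_injective_iff_isUnit.2 hM.isUnit hMxy)
  exact (LinearMap.injective_iff_forall_lt_finrank_singularValues_pos _).1 hinj _ (by simpa)

theorem sigmaMin_le_of_mulVec_eq_smul {M : Matrix (Fin n) (Fin n) ℝ} (hM : M.IsHermitian)
    {v : Fin n → ℝ} (hv : v ≠ 0) {c : ℝ} (hc : 0 ≤ c) (h : M *ᵥ v = c • v) : sigmaMin M ≤ c := by
  set T := toEuclideanLin M with hT
  have hsymm : T.IsSymmetric := isSymmetric_toEuclideanLin_iff.2 hM
  have hTv : T (WithLp.toLp 2 v) = c • WithLp.toLp 2 v := by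
    rw [hT, toLpLin_toLp, toLin'_apply, h, WithLp.toLp_smul]
  have heigen : Module.End.HasEigenvalue (LinearMap.adjoint T ∘ₗ T) (c ^ 2) := by
    refine Module.End.hasEigenvalue_of_hasEigenvector (x := WithLp.toLp 2 v)
      ⟨Module.End.mem_eigenspace_iff.2 ?_, by simpa using hv⟩
    rw [hsymm.adjoint_eq, LinearMap.comp_apply, hTv, map_smul, hTv, smul_smul, sq]
  obtain ⟨i, hi⟩ := T.isSymmetric_adjoint_comp_self.exists_eigenvalues_eq (n := n) (by simp) heigen
  have hsq : T.singularValues i ^ 2 = c ^ 2 := by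
    rw [T.sq_singularValues_fin (by simp) i]
    exact_mod_cast hi
  rw [← (sq_eq_sq₀ (T.singularValues_nonneg _) hc).1 hsq]
  exact T.singularValues_antitone (by omega)

theorem sigmaMin_smul_one_le {M : Matrix (Fin n) (Fin n) ℝ} (hM : 0 ≤ M) :
    sigmaMin M • (1 : Matrix (Fin n) (Fin n) ℝ) ≤ M := by
  have hpsd := nonneg_iff_posSemidef.1 hM
  rw [← Algebra.algebraMap_eq_smul_one, algebraMap_le_iff_le_spectrum (a := M) hpsd.1,
    hpsd.1.spectrum_real_eq_range_eigenvalues]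
  rintro _ ⟨i, rfl⟩
  refine sigmaMin_le_of_mulVec_eq_smul hpsd.1 (v := (hpsd.1.eigenvectorBasis i).ofLp) ?_
    (hpsd.eigenvalues_nonneg i) (hpsd.1.mulVec_eigenvectorBasis i)
  simpa using hpsd.1.eigenvectorBasis.orthonormal.ne_zero i

theorem specNorm_nonneg (M : Matrix (Fin m) (Fin n) ℝ) : 0 ≤ specNorm M := norm_nonneg _

theorem specNorm_of_zero_cols (M : Matrix (Fin m) (Fin 0) ℝ) : specNorm M = 0 :=
  ContinuousLinearMap.opNorm_subsingleton _

theorem transpose_mul_self_le_specNorm_sq (M : Matrix (Fin m) (Fin n) ℝ) :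
    Mᵀ * M ≤ specNorm M ^ 2 • (1 : Matrix (Fin n) (Fin n) ℝ) := by
  refine le_of_dotProduct_mulVec_le (by simp) (by simp) fun v => ?_
  have hnorm := pow_le_pow_left₀ (norm_nonneg _)
    ((toEuclideanLin M).toContinuousLinearMap.le_opNorm (WithLp.toLp 2 v)) 2
  rw [mul_pow, EuclideanSpace.norm_sq_eq, EuclideanSpace.norm_sq_eq] at hnorm
  rw [dotProduct_transpose_mul_self_mulVec, smul_mulVec, one_mulVec, dotProduct_smul, smul_eq_mul]
  simpa [dotProduct, ← sq, specNorm] using hnorm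

theorem le_specNorm_smul_one {M : Matrix (Fin n) (Fin n) ℝ} (hM : Mᵀ = M) :
    M ≤ specNorm M • (1 : Matrix (Fin n) (Fin n) ℝ) := by
  refine le_of_dotProduct_mulVec_le hM (by simp) fun v => ?_
  set T := (toEuclideanLin M).toContinuousLinearMap with hT
  set x : EuclideanSpace ℝ (Fin n) := WithLp.toLp 2 v with hx
  calc v ⬝ᵥ (M *ᵥ v) = inner ℝ (T x) x := by
        simp [hT, hx, EuclideanSpace.inner_eq_star_dotProduct]
    _ ≤ ‖T x‖ * ‖x‖ := real_inner_le_norm _ _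
    _ ≤ specNorm M * ‖x‖ * ‖x‖ :=
        mul_le_mul_of_nonneg_right (T.le_opNorm x) (norm_nonneg _)
    _ = v ⬝ᵥ ((specNorm M • (1 : Matrix (Fin n) (Fin n) ℝ)) *ᵥ v) := by
        rw [mul_assoc, ← real_inner_self_eq_norm_mul_norm, smul_mulVec, one_mulVec,
          dotProduct_smul, smul_eq_mul, hx, EuclideanSpace.inner_eq_star_dotProduct]
        simp only [star_trivial]

end SingularValues

end LoewnerOrder

open LoewnerOrder

namespace MatTuple

section Bounds

variable {N m n : ℕ}

theorem specNorm_le_maxNorm (V : MatTuple N m n) (i : Fin N) : specNorm (V i) ≤ maxNorm V :=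
  le_ciSup (f := fun i => specNorm (V i)) (Set.finite_range _).bddAbove i

theorem maxNorm_nonneg (V : MatTuple N m n) : 0 ≤ maxNorm V :=
  Real.iSup_nonneg fun _ => specNorm_nonneg _

theorem one_nonneg : (0 : MatTuple N n n) ≤ 1 := fun _ => PosSemidef.one.nonneg

theorem nonneg_of_smul_one_le {V : MatTuple N n n} {c : ℝ} (hc : 0 ≤ c) (hV : c • 1 ≤ V) : 0 ≤ V :=
  (smul_nonneg hc one_nonneg).trans hV

theorem le_of_smul_one_le_smul_one [Nonempty (Fin N)] (hn : 0 < n) {c c' : ℝ}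
    (h : c • (1 : MatTuple N n n) ≤ c' • 1) : c ≤ c' := by
  obtain ⟨i⟩ := ‹Nonempty (Fin N)›
  simpa [smul_mulVec] using dotProduct_mulVec_mono (h i) (Pi.single ⟨0, hn⟩ 1)

theorem le_maxNorm_smul_one {V : MatTuple N n n} (hV : ∀ i, (V i)ᵀ = V i) :
    V ≤ maxNorm V • 1 := fun i =>
  (le_specNorm_smul_one (hV i)).trans
    (smul_le_smul_of_nonneg_right (specNorm_le_maxNorm V i) (one_nonneg i))

theorem transpose_mul_self_le_maxNorm_sq (V : MatTuple N m n) (i : Fin N) :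
    (V i)ᵀ * V i ≤ maxNorm V ^ 2 • (1 : Matrix (Fin n) (Fin n) ℝ) :=
  (transpose_mul_self_le_specNorm_sq (V i)).trans
    (smul_le_smul_of_nonneg_right
      (pow_le_pow_left₀ (specNorm_nonneg _) (specNorm_le_maxNorm V i) 2) (one_nonneg i))

theorem lambdaMin_le_sigmaMin (V : MatTuple N n n) (i : Fin N) : lambdaMin V ≤ sigmaMin (V i) :=
  ciInf_le (f := fun i => sigmaMin (V i)) (Set.finite_range _).bddBelow i

theorem lambdaMin_smul_one_le {V : MatTuple N n n} (hV : 0 ≤ V) :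
    lambdaMin V • (1 : MatTuple N n n) ≤ V := fun i =>
  (smul_le_smul_of_nonneg_right (lambdaMin_le_sigmaMin V i) (one_nonneg i)).trans
    (sigmaMin_smul_one_le (hV i))

theorem lambdaMin_pos [Nonempty (Fin N)] (hn : 0 < n) {V : MatTuple N n n}
    (hV : ∀ i, (V i).PosDef) : 0 < lambdaMin V := by
  obtain ⟨i, hi⟩ := exists_eq_ciInf_of_finite (f := fun i => sigmaMin (V i))
  rw [lambdaMin, ← hi]
  exact sigmaMin_pos hn (hV i)

theorem exists_pos_smul_one_le [Nonempty (Fin N)] {V : MatTuple N n n}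
    (hV : ∀ i, (V i).PosDef) : ∃ c : ℝ, 0 < c ∧ c • 1 ≤ V := by
  rcases Nat.eq_zero_or_pos n with rfl | hn
  · exact ⟨1, one_pos, (Subsingleton.elim _ _).le⟩
  · exact ⟨_, lambdaMin_pos hn hV, lambdaMin_smul_one_le fun i => (hV i).posSemidef.nonneg⟩

end Bounds

section Pairing

variable {N d : ℕ}

/-- The bilinear trace pairing `∑ i, tr (X i * Y i)` on tuples of square matrices.  Between tuples
of second moments and tuples of quadratic forms it computes expected quadratic costs. -/
def pairing : MatTuple N d d →ₗ[ℝ] MatTuple N d d →ₗ[ℝ] ℝ :=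
  LinearMap.mk₂ ℝ (fun X Y => ∑ i, (X i * Y i).trace)
    (fun X X' Y => by simp [Matrix.add_mul, Finset.sum_add_distrib])
    (fun c X Y => by simp [Finset.mul_sum])
    (fun X Y Y' => by simp [Matrix.mul_add, Finset.sum_add_distrib])
    (fun c X Y => by simp [Finset.mul_sum])

theorem pairing_apply (X Y : MatTuple N d d) : pairing X Y = ∑ i, (X i * Y i).trace := rfl

theorem pairing_one (X : MatTuple N d d) : pairing X 1 = ∑ i, (X i).trace := by
  simp only [pairing_apply, Pi.one_apply, Matrix.mul_one]

theorem pairing_comm (X Y : MatTuple N d d) : pairing X Y = pairing Y X := by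
  simp only [pairing_apply, trace_mul_comm (X _)]

theorem pairing_nonneg {X Y : MatTuple N d d} (hX : 0 ≤ X) (hY : 0 ≤ Y) : 0 ≤ pairing X Y := by
  rw [pairing_apply]
  exact Finset.sum_nonneg fun i _ => trace_mul_nonneg (hX i) (hY i)

theorem pairing_mono_right {X Y Z : MatTuple N d d} (hX : 0 ≤ X) (h : Y ≤ Z) :
    pairing X Y ≤ pairing X Z := by
  rw [← sub_nonneg, ← map_sub]
  exact pairing_nonneg hX (sub_nonneg.2 h)

theorem pairing_mono_left {X Y Z : MatTuple N d d} (hX : 0 ≤ X) (h : Y ≤ Z) :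
    pairing Y X ≤ pairing Z X := by
  rw [pairing_comm Y, pairing_comm Z]
  exact pairing_mono_right hX h

theorem mul_pairing_one_le {X Y : MatTuple N d d} (hX : 0 ≤ X) {c : ℝ} (hY : c • 1 ≤ Y) :
    c * pairing X 1 ≤ pairing X Y := by
  simpa only [map_smul, smul_eq_mul] using pairing_mono_right hX hY

theorem pairing_le_mul_pairing_one {X Y : MatTuple N d d} (hX : 0 ≤ X) {c : ℝ} (hY : Y ≤ c • 1) :
    pairing X Y ≤ c * pairing X 1 := by
  simpa only [map_smul, smul_eq_mul] using pairing_mono_right hX hY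

theorem continuous_pairing_right (X : MatTuple N d d) : Continuous (pairing X) :=
  LinearMap.continuous_of_finiteDimensional _

theorem trace_le_pairing_one {Y : MatTuple N d d} (hY : 0 ≤ Y) (i : Fin N) :
    (Y i).trace ≤ pairing Y 1 := by
  rw [pairing_one]
  exact Finset.single_le_sum (f := fun i => (Y i).trace)
    (fun j _ => trace_nonneg (hY j)) (Finset.mem_univ i)

theorem abs_apply_le_pairing_one {Y : MatTuple N d d} (hY : 0 ≤ Y) (i : Fin N) (a b : Fin d) :
    |Y i a b| ≤ pairing Y 1 :=
  (abs_apply_le_trace (hY i) a b).trans (trace_le_pairing_one hY i)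

theorem le_pairing_one_smul_one {Y : MatTuple N d d} (hY : 0 ≤ Y) : Y ≤ pairing Y 1 • 1 :=
  fun i => (le_trace_smul_one (hY i)).trans
    (smul_le_smul_of_nonneg_right (trace_le_pairing_one hY i) (one_nonneg i))

theorem exists_le_smul_of_smul_one_le {Y Z : MatTuple N d d} (hY : 0 ≤ Y) {c : ℝ} (hc : 0 < c)
    (hZ : c • 1 ≤ Z) : ∃ a : ℝ, 0 ≤ a ∧ Y ≤ a • Z := by
  have ha : 0 ≤ pairing Y 1 / c := div_nonneg (pairing_nonneg hY one_nonneg) hc.le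
  refine ⟨pairing Y 1 / c, ha, (le_pairing_one_smul_one hY).trans ?_⟩
  have hcZ := smul_le_smul_of_nonneg_left hZ ha
  rwa [smul_smul, div_mul_cancel₀ _ hc.ne'] at hcZ

theorem summable_of_sum_pairing_one_le {Y : ℕ → MatTuple N d d} (hY : ∀ t, 0 ≤ Y t) {c : ℝ}
    (h : ∀ n, ∑ t ∈ Finset.range n, pairing (Y t) 1 ≤ c) : Summable Y := by
  have hsummable : Summable fun t => pairing (Y t) 1 :=
    summable_of_sum_range_le (fun t => pairing_nonneg (hY t) one_nonneg) h
  exact Pi.summable.2 fun i => Pi.summable.2 fun a => Pi.summable.2 fun b =>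
    Summable.of_norm_bounded hsummable fun t => abs_apply_le_pairing_one (hY t) i a b

theorem tsum_pow_apply_eq_add (T : MatTuple N d d →ₗ[ℝ] MatTuple N d d) {Y : MatTuple N d d}
    (h : Summable fun t => (T ^ t) Y) : ∑' t, (T ^ t) Y = Y + T (∑' t, (T ^ t) Y) := by
  rw [h.map_tsum T (LinearMap.continuous_of_finiteDimensional T), h.tsum_eq_zero_add]
  simp only [pow_zero, Module.End.one_apply, pow_succ', Module.End.mul_apply]

theorem sum_pow_apply_le {T : MatTuple N d d →ₗ[ℝ] MatTuple N d d} (hT : Monotone T)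
    {Y Z : MatTuple N d d} (hZ : 0 ≤ Z) (h : Y + T Z ≤ Z) (n : ℕ) :
    ∑ t ∈ Finset.range n, (T ^ t) Y ≤ Z := by
  induction n with
  | zero => simpa only [Finset.range_zero, Finset.sum_empty] using hZ
  | succ n ih =>
    rw [Finset.sum_range_succ']
    simp only [pow_zero, Module.End.one_apply, pow_succ', Module.End.mul_apply]
    rw [← map_sum, add_comm]
    exact (add_le_add le_rfl (hT ih)).trans h

theorem pow_apply_nonneg {T : MatTuple N d d →ₗ[ℝ] MatTuple N d d} (hT : ∀ Y, 0 ≤ Y → 0 ≤ T Y)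
    {Y : MatTuple N d d} (hY : 0 ≤ Y) (t : ℕ) : 0 ≤ (T ^ t) Y := by
  induction t with
  | zero => simpa only [pow_zero, Module.End.one_apply] using hY
  | succ t ih => simpa only [pow_succ', Module.End.mul_apply] using hT _ ih

end Pairing

section Frobenius

variable {N m n : ℕ}

/-- The inner product `∑ i, tr ((G i)ᵀ * D i)` on tuples of matrices, as a functional of `D`. -/
def frobInner (G : MatTuple N m n) : MatTuple N m n →ₗ[ℝ] ℝ where
  toFun D := ∑ i, ((G i)ᵀ * D i).trace
  map_add' D D' := by simp [Matrix.mul_add, Finset.sum_add_distrib]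
  map_smul' c D := by simp [Finset.mul_sum]

/-- The square of the norm of `frobInner`. It is used in place of a norm instance, since
matrices carry no canonical norm. -/
def frobSq (D : MatTuple N m n) : ℝ := ∑ i, ((D i)ᵀ * D i).trace

theorem frobInner_apply (G D : MatTuple N m n) : frobInner G D = ∑ i, ((G i)ᵀ * D i).trace := rfl

theorem frobInner_self (G : MatTuple N m n) : frobInner G G = frobSq G := rfl

theorem frobInner_single (G : MatTuple N m n) (i : Fin N) (a : Fin m) (b : Fin n) :
    frobInner G (Pi.single i (Matrix.single a b 1)) = G i a b := by
  rw [frobInner_apply, Finset.sum_eq_single i (fun j _ hj => by simp [hj]) (by simp),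
    Pi.single_eq_same, trace_mul_comm, trace_single_mul, one_smul, transpose_apply]

theorem trace_transpose_mul_self_nonneg (D : Matrix (Fin m) (Fin n) ℝ) : 0 ≤ (Dᵀ * D).trace :=
  trace_nonneg (transpose_mul_self_nonneg D)

theorem frobSq_nonneg (D : MatTuple N m n) : 0 ≤ frobSq D :=
  Finset.sum_nonneg fun i _ => trace_transpose_mul_self_nonneg (D i)

theorem frobSq_eq_sum_sq (D : MatTuple N m n) : frobSq D = ∑ i, ∑ a, ∑ b, D i a b ^ 2 := by
  refine Finset.sum_congr rfl fun i _ => ?_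
  rw [Finset.sum_comm]
  simp only [trace, diag_apply, mul_apply, transpose_apply, sq]

theorem sq_apply_le_frobSq (D : MatTuple N m n) (i : Fin N) (a : Fin m) (b : Fin n) :
    D i a b ^ 2 ≤ frobSq D := by
  rw [frobSq_eq_sum_sq]
  calc D i a b ^ 2 ≤ ∑ b, D i a b ^ 2 :=
        Finset.single_le_sum (f := fun b => D i a b ^ 2) (fun _ _ => by positivity)
          (Finset.mem_univ b)
    _ ≤ ∑ a, ∑ b, D i a b ^ 2 :=
        Finset.single_le_sum (f := fun a => ∑ b, D i a b ^ 2) (fun _ _ => by positivity)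
          (Finset.mem_univ a)
    _ ≤ ∑ i, ∑ a, ∑ b, D i a b ^ 2 :=
        Finset.single_le_sum (f := fun i => ∑ a, ∑ b, D i a b ^ 2) (fun _ _ => by positivity)
          (Finset.mem_univ i)

theorem frobSq_smul (c : ℝ) (D : MatTuple N m n) : frobSq (c • D) = c ^ 2 * frobSq D := by
  simp only [frobSq_eq_sum_sq, Finset.mul_sum, Pi.smul_apply, Matrix.smul_apply, smul_eq_mul,
    mul_pow]

theorem frobSq_neg (D : MatTuple N m n) : frobSq (-D) = frobSq D := by
  simp only [frobSq_eq_sum_sq, Pi.neg_apply, Matrix.neg_apply, neg_sq]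

theorem frobSq_sub_comm (D D' : MatTuple N m n) : frobSq (D - D') = frobSq (D' - D) := by
  rw [← neg_sub, frobSq_neg]

theorem frobSq_eq_zero {D : MatTuple N m n} : frobSq D = 0 ↔ D = 0 := by
  refine ⟨fun h => ?_, fun h => by simp [h, frobSq]⟩
  ext i a b
  exact pow_eq_zero_iff two_ne_zero |>.1 <|
    le_antisymm (h ▸ sq_apply_le_frobSq D i a b) (sq_nonneg _)

theorem continuous_frobSq : Continuous (frobSq : MatTuple N m n → ℝ) := by
  unfold frobSq
  fun_prop

theorem transpose_mul_self_le_frobSq (D : MatTuple N m n) (i : Fin N) :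
    (D i)ᵀ * D i ≤ frobSq D • (1 : Matrix (Fin n) (Fin n) ℝ) :=
  (le_trace_smul_one (transpose_mul_self_nonneg (D i))).trans
    (smul_le_smul_of_nonneg_right (Finset.single_le_sum (f := fun i => ((D i)ᵀ * D i).trace)
      (fun i _ => trace_transpose_mul_self_nonneg (D i)) (Finset.mem_univ i)) (one_nonneg i))

theorem two_smul_le_of_transpose_eq {Z : MatTuple N n n} (hZ : ∀ i, (Z i)ᵀ = Z i) {w : ℝ}
    (hw : 0 < w) : (2 : ℝ) • Z ≤ (w * frobSq Z + w⁻¹) • 1 := fun i => by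
  have hyoung := young_of_nonneg (PosSemidef.one.nonneg : (0 : Matrix (Fin n) (Fin n) ℝ) ≤ 1)
    (Z i) 1 hw
  have hsq := smul_le_smul_of_nonneg_left (transpose_mul_self_le_frobSq Z i) hw.le
  simp only [Matrix.mul_one, transpose_one, hZ i, Matrix.one_mul] at hyoung hsq
  simp only [Pi.smul_apply, Pi.one_apply, two_smul, add_smul, mul_smul]
  exact hyoung.trans (add_le_add hsq le_rfl)

theorem sq_mul_frobSq_le {X : MatTuple N n n} {c : ℝ} (hc : 0 ≤ c) (hX : c • 1 ≤ X)
    (M : MatTuple N m n) : c ^ 2 * frobSq M ≤ frobSq fun i => M i * X i := by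
  rw [frobSq, frobSq, Finset.mul_sum]
  refine Finset.sum_le_sum fun i _ => ?_
  have htrace := trace_mul_mono_right (transpose_mul_self_nonneg (M i))
    (sq_smul_one_le_mul_transpose hc (hX i))
  rw [Matrix.mul_smul, Matrix.mul_one, trace_smul, smul_eq_mul] at htrace
  refine htrace.trans_eq ?_
  rw [transpose_mul, Matrix.mul_assoc (X i)ᵀ, trace_mul_comm (X i)ᵀ]
  simp only [Matrix.mul_assoc]

theorem eventually_le_smul_one {ι : Type*} {l : Filter ι} {Z : ι → MatTuple N n n}
    (hsymm : ∀ x i, (Z x i)ᵀ = Z x i) (hZ : Tendsto Z l (𝓝 0)) {c : ℝ} (hc : 0 < c) :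
    ∀ᶠ x in l, Z x ≤ c • 1 := by
  have hfrob : Tendsto (fun x => frobSq (Z x)) l (𝓝 0) := by
    simpa only [Function.comp_def, frobSq_eq_zero.2] using (continuous_frobSq.tendsto 0).comp hZ
  filter_upwards [hfrob.eventually_lt_const (by positivity : 0 < c ^ 2)] with x hx
  have htwo : (2 : ℝ) • Z x ≤ (2 : ℝ) • c • 1 := by
    refine (two_smul_le_of_transpose_eq (hsymm x) (inv_pos.2 hc)).trans ?_
    rw [smul_smul]
    refine smul_le_smul_of_nonneg_right ?_ one_nonneg
    rw [inv_inv]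
    calc c⁻¹ * frobSq (Z x) + c ≤ c⁻¹ * c ^ 2 + c := by gcongr
      _ = 2 * c := by field_simp; ring
  exact (smul_le_smul_iff_of_pos_left two_pos).1 htwo

theorem mul_frobSq_le_pairing {X : MatTuple N n n} {Y : MatTuple N m m} {c r : ℝ} (hc : 0 ≤ c)
    (hr : 0 ≤ r) (hX : c • 1 ≤ X) (hY : r • 1 ≤ Y) (M : MatTuple N m n) :
    c * r * frobSq M ≤ pairing X fun i => (M i)ᵀ * Y i * M i := by
  have hle (i : Fin N) : r • ((M i)ᵀ * M i) ≤ (M i)ᵀ * Y i * M i := by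
    simpa only [Pi.smul_apply, Pi.one_apply, Matrix.mul_smul, Matrix.mul_one, Matrix.smul_mul]
      using transpose_mul_mul_mono (hY i) (M i)
  have hnonneg (i : Fin N) : 0 ≤ (M i)ᵀ * Y i * M i :=
    (smul_nonneg hr (transpose_mul_self_nonneg (M i))).trans (hle i)
  have hfrob : r * frobSq M ≤ pairing (fun i => (M i)ᵀ * Y i * M i) 1 := by
    simpa only [Pi.smul_def, pairing_one, trace_smul, smul_eq_mul, ← Finset.mul_sum, frobSq]
      using pairing_mono_left one_nonneg hle
  rw [mul_assoc, pairing_comm]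
  exact (mul_le_mul_of_nonneg_left hfrob hc).trans (mul_pairing_one_le hnonneg hX)

theorem pairing_transpose_mul_self_le {X : MatTuple N n n} {c : ℝ} (hX : X ≤ c • 1)
    (M : MatTuple N m n) : (pairing X fun i => (M i)ᵀ * M i) ≤ c * frobSq M := by
  rw [pairing_comm]
  refine (pairing_le_mul_pairing_one (fun i => transpose_mul_self_nonneg (M i)) hX).trans_eq ?_
  rw [pairing_one, frobSq]

section Derivative

open scoped Matrix.Norms.Elementwise

theorem frobSq_le_mul_norm_sq (D : MatTuple N m n) : frobSq D ≤ N * (m * n) * ‖D‖ ^ 2 := by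
  have hentry (i a b) : D i a b ^ 2 ≤ ‖D‖ ^ 2 := by
    rw [← sq_abs]
    exact pow_le_pow_left₀ (abs_nonneg _)
      ((norm_entry_le_entrywise_sup_norm _).trans (norm_le_pi_norm D i)) 2
  calc frobSq D = ∑ i, ∑ a, ∑ b, D i a b ^ 2 := frobSq_eq_sum_sq D
    _ ≤ ∑ _i : Fin N, ∑ _a : Fin m, ∑ _b : Fin n, ‖D‖ ^ 2 :=
      Finset.sum_le_sum fun i _ => Finset.sum_le_sum fun a _ => Finset.sum_le_sum fun b _ =>
        hentry i a b
    _ = N * (m * n) * ‖D‖ ^ 2 := by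
      simp only [Finset.sum_const, Finset.card_univ, Fintype.card_fin, nsmul_eq_mul]
      ring

theorem hasFDerivAt_of_abs_sub_le_frobSq {f : MatTuple N m n → ℝ}
    {f' : MatTuple N m n →L[ℝ] ℝ} {K : MatTuple N m n} {c : ℝ} (hc : 0 ≤ c)
    (h : ∀ᶠ K' in 𝓝 K, |f K' - f K - f' (K' - K)| ≤ c * frobSq (K' - K)) :
    HasFDerivAt f f' K := by
  refine hasFDerivAt_iff_isLittleO.2 <| Asymptotics.IsBigO.trans_isLittleO ?_
    (Asymptotics.isLittleO_pow_sub_sub K one_lt_two)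
  refine Asymptotics.IsBigO.of_bound (c * (N * (m * n))) (h.mono fun K' hK' => ?_)
  rw [Real.norm_eq_abs, Real.norm_of_nonneg (sq_nonneg ‖K' - K‖), mul_assoc]
  exact hK'.trans (mul_le_mul_of_nonneg_left (frobSq_le_mul_norm_sq _) hc)

theorem hasFDerivAt_eq_zero_of_isLocalMin {f : MatTuple N m n → ℝ}
    {f' : MatTuple N m n →L[ℝ] ℝ} {K : MatTuple N m n} (hmin : IsLocalMin f K)
    (hf : HasFDerivAt f f' K) : f' = 0 :=
  hmin.hasFDerivAt_eq_zero hf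

end Derivative

end Frobenius

theorem pairing_single (i : Fin N) (v : Fin n → ℝ) (V : MatTuple N n n) :
    pairing (Pi.single i (vecMulVec v v)) V = v ⬝ᵥ (V i *ᵥ v) := by
  rw [pairing_apply, Finset.sum_eq_single i (fun j _ hj => by simp [hj]) (by simp),
    Pi.single_eq_same, vecMulVec_mul, trace_vecMulVec, dotProduct_comm, ← dotProduct_mulVec]

theorem tendsto_of_tendsto_frobSq_sub {K : ℕ → MatTuple N m n} {L : MatTuple N m n}
    (h : Tendsto (fun t => frobSq (K t - L)) atTop (𝓝 0)) : Tendsto K atTop (𝓝 L) := by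
  refine tendsto_pi_nhds.2 fun i => tendsto_pi_nhds.2 fun a => tendsto_pi_nhds.2 fun b => ?_
  rw [← tendsto_sub_nhds_zero_iff]
  have hsqrt : Tendsto (fun t => √(frobSq (K t - L))) atTop (𝓝 0) := by simpa using h.sqrt
  exact squeeze_zero_norm
    (fun t => Real.abs_le_sqrt (sq_apply_le_frobSq (K t - L) i a b)) hsqrt

end MatTuple

section Contraction

variable {e : ℕ → ℝ} {ρ : ℝ}

theorem le_pow_mul_of_le_mul (he : ∀ n, 0 ≤ e n) (h : ∀ n, e (n + 1) ≤ ρ * e n) (n : ℕ) :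
    e n ≤ ρ ^ n * e 0 := by
  rcases (he 0).eq_or_lt with h0 | h0
  · have hzero : ∀ n, e n = 0 := fun n => by
      induction n with
      | zero => exact h0.symm
      | succ n ih => exact le_antisymm (by simpa [ih] using h n) (he _)
    simp [hzero]
  · have hρ : 0 ≤ ρ := nonneg_of_mul_nonneg_left ((he 1).trans (h 0)) h0
    exact le_geom hρ n fun m _ => h m

theorem tendsto_zero_of_le_mul (hρ : ρ < 1) (he : ∀ n, 0 ≤ e n)
    (h : ∀ n, e (n + 1) ≤ ρ * e n) : Tendsto e atTop (𝓝 0) := by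
  have hmax : ∀ n, e (n + 1) ≤ max ρ 0 * e n := fun n =>
    (h n).trans (mul_le_mul_of_nonneg_right (le_max_left _ _) (he n))
  refine squeeze_zero he (le_pow_mul_of_le_mul he hmax) ?_
  simpa using (tendsto_pow_atTop_nhds_zero_of_lt_one (le_max_right ρ 0)
    (max_lt hρ one_pos)).mul_const (e 0)

end Contraction

section SecondMoment

variable {W : Type*} [MeasurableSpace W] {ν : Measure W} {n : ℕ} {x : W → Fin n → ℝ}

theorem secondMoment_const [IsProbabilityMeasure ν] (v : Fin n → ℝ) :
    secondMoment ν (fun _ => v) = vecMulVec v v := by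
  ext a b
  simp [secondMoment, vecMulVec_apply]

theorem integrable_apply_mul_apply (hx : MemLp x 2 ν) (a b : Fin n) :
    Integrable (fun w => x w a * x w b) ν :=
  (hx.eval a).integrable_mul (hx.eval b)

theorem memLp_mulVec {m : ℕ} {q : ℝ≥0∞} (hx : MemLp x q ν) (M : Matrix (Fin m) (Fin n) ℝ) :
    MemLp (fun w => M *ᵥ x w) q ν :=
  M.mulVecLin.toContinuousLinearMap.comp_memLp' hx

theorem secondMoment_mulVec {m : ℕ} (hx : MemLp x 2 ν) (M : Matrix (Fin m) (Fin n) ℝ) :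
    secondMoment ν (fun w => M *ᵥ x w) = M * secondMoment ν x * Mᵀ := by
  ext a b
  have hint := integrable_apply_mul_apply hx
  have hexpand : ∀ w, (M *ᵥ x w) a * (M *ᵥ x w) b
      = ∑ c, ∑ e, M b c * (M a e * (x w e * x w c)) := fun w => by
    simp only [mulVec, dotProduct, Finset.sum_mul_sum]
    rw [Finset.sum_comm]
    exact Finset.sum_congr rfl fun c _ => Finset.sum_congr rfl fun e _ => by ring
  simp only [secondMoment, of_apply, hexpand, mul_apply, transpose_apply, Finset.sum_mul]
  rw [integral_finsetSum _ fun c _ => integrable_finsetSum _ fun e _ =>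
    ((hint e c).const_mul _).const_mul _]
  refine Finset.sum_congr rfl fun c _ => ?_
  rw [integral_finsetSum _ fun e _ => ((hint e c).const_mul _).const_mul _]
  refine Finset.sum_congr rfl fun e _ => ?_
  rw [integral_const_mul, integral_const_mul, mul_comm]

theorem dotProduct_mulVec_eq_sum_sum (Y : Matrix (Fin n) (Fin n) ℝ) (v : Fin n → ℝ) :
    v ⬝ᵥ (Y *ᵥ v) = ∑ a, ∑ b, Y b a * (v a * v b) := by
  rw [Finset.sum_comm]
  simp only [dotProduct, mulVec, Finset.mul_sum]
  exact Finset.sum_congr rfl fun a _ => Finset.sum_congr rfl fun b _ => by ring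

theorem integrable_dotProduct_mulVec (hx : MemLp x 2 ν) (Y : Matrix (Fin n) (Fin n) ℝ) :
    Integrable (fun w => x w ⬝ᵥ (Y *ᵥ x w)) ν := by
  simp only [dotProduct_mulVec_eq_sum_sum]
  exact integrable_finsetSum _ fun a _ => integrable_finsetSum _ fun b _ =>
    (integrable_apply_mul_apply hx a b).const_mul _

theorem integral_dotProduct_mulVec (hx : MemLp x 2 ν) (Y : Matrix (Fin n) (Fin n) ℝ) :
    ∫ w, x w ⬝ᵥ (Y *ᵥ x w) ∂ν = (secondMoment ν x * Y).trace := by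
  have hint := fun a b => (integrable_apply_mul_apply hx a b).const_mul (Y b a)
  simp only [dotProduct_mulVec_eq_sum_sum, trace, diag_apply, mul_apply, secondMoment, of_apply]
  rw [integral_finsetSum _ fun a _ => integrable_finsetSum _ fun b _ => hint a b]
  refine Finset.sum_congr rfl fun a _ => ?_
  rw [integral_finsetSum _ fun b _ => hint a b]
  refine Finset.sum_congr rfl fun b _ => ?_
  rw [integral_const_mul, mul_comm]

variable {τ : Type*} [Fintype τ] [MeasurableSpace τ] [MeasurableSingletonClass τ] {Z : W → τ}

theorem integral_eq_sum_setIntegral_fiber (hZ : Measurable Z) {g : W → ℝ} (hg : Integrable g ν) :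
    ∫ w, g w ∂ν = ∑ z, ∫ w in {w | Z w = z}, g w ∂ν := by
  have hcover : ⋃ z, {w | Z w = z} = Set.univ := by ext w; simp
  have hdisj : Pairwise (Function.onFun Disjoint fun z => {w | Z w = z}) := fun z z' hne =>
    Set.disjoint_left.2 fun w hw hw' => hne (Eq.trans (Eq.symm hw) hw')
  have hmeas : ∀ z, MeasurableSet {w | Z w = z} := fun z => hZ (measurableSet_singleton z)
  rw [← integral_iUnion_fintype hmeas hdisj fun _ => hg.integrableOn, hcover,
    Measure.restrict_univ]

theorem secondMoment_eq_sum_restrict_fiber (hZ : Measurable Z) (hx : MemLp x 2 ν) :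
    secondMoment ν x = ∑ z, secondMoment (ν.restrict {w | Z w = z}) x := by
  ext a b
  rw [Matrix.sum_apply]
  exact integral_eq_sum_setIntegral_fiber hZ (integrable_apply_mul_apply hx a b)

end SecondMoment

section Markov

variable {ι V W : Type*} [MeasurableSpace ι] [MeasurableSpace V] [MeasurableSpace W]

/-- The process `ω` is a Markov chain with transition matrix `p`, and it is independent of the
initial datum `y`.  The Markov property is written without division, so that the law of `ω 0` is
unconstrained and conditioning on `ω 0` preserves the notion. -/
structure IsMarkovIndep (p : Matrix ι ι ℝ) (ν : Measure W) (y : W → V) (ω : ℕ → W → ι) :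
    Prop where
  aemeasurable_init : AEMeasurable y ν
  measurable_mode : ∀ t, Measurable (ω t)
  markov : ∀ (t : ℕ) (s : ℕ → ι) (j : ι),
    ν.real {w | (∀ r ≤ t, ω r w = s r) ∧ ω (t + 1) w = j}
      = p (s t) j * ν.real {w | ∀ r ≤ t, ω r w = s r}
  indep : IndepFun y (fun w t => ω t w) ν

namespace IsMarkovIndep

variable {p : Matrix ι ι ℝ} {ν : Measure W} {y : W → V} {ω : ℕ → W → ι}
  {f : V → (ℕ → ι) → ℝ} {t : ℕ}

theorem setIntegral_init (hω : IsMarkovIndep p ν y ω) {g : V → ℝ} (hg : Measurable g)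
    {F : Set (ℕ → ι)} (hF : MeasurableSet F) :
    ∫ w in {w | (fun r => ω r w) ∈ F}, g (y w) ∂ν
      = ν.real {w | (fun r => ω r w) ∈ F} * ∫ w, g (y w) ∂ν :=
  Indep.setIntegral_eq_mul (measurable_pi_iff.2 hω.measurable_mode).comap_le hω.indep.symm
    hω.aemeasurable_init ⟨F, hF, rfl⟩ hg.aestronglyMeasurable

variable [MeasurableSingletonClass ι]

theorem cond_init [IsFiniteMeasure ν] (hω : IsMarkovIndep p ν y ω) {i : ι}
    (hi : ν {w | ω 0 w = i} ≠ 0) (v : V) :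
    IsMarkovIndep p (ν[|{w | ω 0 w = i}]) (fun _ => v) ω := by
  have := cond_isProbabilityMeasure hi
  have hmeas : MeasurableSet {w | ω 0 w = i} := hω.measurable_mode 0 (measurableSet_singleton i)
  refine ⟨aemeasurable_const, hω.measurable_mode, fun t s j => ?_, indepFun_const_left _ _⟩
  have hcond : ∀ F, (ν[|{w | ω 0 w = i}]).real F
      = (ν.real {w | ω 0 w = i})⁻¹ * ν.real ({w | ω 0 w = i} ∩ F) := fun F => by
    rw [measureReal_def, cond_apply hmeas, ENNReal.toReal_mul, ENNReal.toReal_inv,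
      measureReal_def, measureReal_def]
  have hsub : {w | (∀ r ≤ t, ω r w = s r) ∧ ω (t + 1) w = j} ⊆ {w | ∀ r ≤ t, ω r w = s r} :=
    fun w hw => hw.1
  by_cases hs : s 0 = i
  · have hinter : ∀ F ⊆ {w | ∀ r ≤ t, ω r w = s r}, {w | ω 0 w = i} ∩ F = F := fun F hF =>
      Set.inter_eq_right.2 fun w hw => (hF hw 0 t.zero_le).trans hs
    rw [hcond, hcond, hinter _ hsub, hinter _ subset_rfl, hω.markov t s j, mul_left_comm]
  · have hinter : ∀ F ⊆ {w | ∀ r ≤ t, ω r w = s r}, {w | ω 0 w = i} ∩ F = ∅ := fun F hF =>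
      Set.eq_empty_of_forall_notMem fun w hw => hs ((hF hw.2 0 t.zero_le).symm.trans hw.1)
    rw [hcond, hcond, hinter _ hsub, hinter _ subset_rfl, measureReal_empty, mul_zero, mul_zero]

variable [Fintype ι]

/-- The sequence `fun r => σ (Fin.ofNat (t + 1) r)` extends the history `σ` beyond time `t`. -/
theorem setIntegral_eq_sum_history (hω : IsMarkovIndep p ν y ω)
    (hdep : ∀ v, DependsOn (f v) (Set.Iic t)) (hmeas : ∀ s, Measurable fun v => f v s)
    (hint : Integrable (fun w => f (y w) fun r => ω r w) ν)
    {F : Set (ℕ → ι)} (hF : MeasurableSet F) :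
    ∫ w in {w | (fun r => ω r w) ∈ F}, f (y w) (fun r => ω r w) ∂ν
      = ∑ σ : Fin (t + 1) → ι,
        ν.real {w | (∀ r ≤ t, ω r w = σ (Fin.ofNat (t + 1) r)) ∧ (fun r => ω r w) ∈ F}
          * ∫ w, f (y w) (fun r => σ (Fin.ofNat (t + 1) r)) ∂ν := by
  have hhist : Measurable fun w (r : Fin (t + 1)) => ω r w :=
    measurable_pi_iff.2 fun r => hω.measurable_mode r
  rw [integral_eq_sum_setIntegral_fiber hhist hint.integrableOn]
  refine Finset.sum_congr rfl fun σ _ => ?_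
  set s : ℕ → ι := fun r => σ (Fin.ofNat (t + 1) r)
  have hfiber : {w | (fun r : Fin (t + 1) => ω r w) = σ} = {w | ∀ r ≤ t, ω r w = s r} := by
    ext w
    simp only [Set.mem_ofPred_eq, funext_iff, s]
    refine ⟨fun hw r hr => ?_, fun hw r => ?_⟩
    · simpa [Nat.mod_eq_of_lt (Nat.lt_succ_of_le hr)] using hw (Fin.ofNat (t + 1) r)
    · simpa using hw r (Nat.le_of_lt_succ r.2)
  have hset : MeasurableSet {s' : ℕ → ι | ∀ r ≤ t, s' r = s r} := by
    have : {s' : ℕ → ι | ∀ r ≤ t, s' r = s r} = Set.pi (Set.Iic t) fun r => {s r} := by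
      ext s'; simp
    rw [this]
    exact MeasurableSet.pi (Set.to_countable _) fun r _ => measurableSet_singleton _
  have hmeas_fiber : MeasurableSet {w | ∀ r ≤ t, ω r w = s r} :=
    measurable_pi_iff.2 hω.measurable_mode hset
  rw [hfiber, Measure.restrict_restrict hmeas_fiber]
  exact (setIntegral_congr_fun (hmeas_fiber.inter (measurable_pi_iff.2 hω.measurable_mode hF))
    fun w hw => hdep (y w) hw.1).trans (hω.setIntegral_init (hmeas s) (hset.inter hF))

theorem setIntegral_succ (hω : IsMarkovIndep p ν y ω)
    (hdep : ∀ v, DependsOn (f v) (Set.Iic t)) (hmeas : ∀ s, Measurable fun v => f v s)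
    (hint : Integrable (fun w => f (y w) fun r => ω r w) ν) (j : ι) :
    ∫ w in {w | ω (t + 1) w = j}, f (y w) (fun r => ω r w) ∂ν
      = ∑ i, p i j * ∫ w in {w | ω t w = i}, f (y w) (fun r => ω r w) ∂ν := by
  have hmode : ∀ r i, MeasurableSet {s : ℕ → ι | s r = i} := fun r i =>
    (measurable_pi_apply r : Measurable fun s : ℕ → ι => s r) (measurableSet_singleton i)
  have hsum := fun r i => hω.setIntegral_eq_sum_history hdep hmeas hint (hmode r i)
  simp only [Set.mem_ofPred_eq] at hsum
  simp only [hsum, Finset.mul_sum]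
  rw [Finset.sum_comm]
  refine Finset.sum_congr rfl fun σ _ => ?_
  set s : ℕ → ι := fun r => σ (Fin.ofNat (t + 1) r)
  rw [Finset.sum_eq_single (s t) (fun i _ hi => ?_) (by simp)]
  · have hlast : {w | (∀ r ≤ t, ω r w = s r) ∧ ω t w = s t} = {w | ∀ r ≤ t, ω r w = s r} :=
      Set.inter_eq_left.2 fun w hw => hw t le_rfl
    rw [hlast, hω.markov t s j, mul_assoc]
  · have hempty : {w | (∀ r ≤ t, ω r w = s r) ∧ ω t w = i} = ∅ :=
      Set.eq_empty_of_forall_notMem fun w hw => hi (hw.2.symm.trans (hw.1 t le_rfl))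
    rw [hempty, measureReal_empty, zero_mul, mul_zero]

end IsMarkovIndep

end Markov

open MatTuple

namespace MJLS

variable {N d k : ℕ} (S : MJLS N d k)

/-- The standing assumptions: a stochastic transition matrix and positive definite weights. -/
structure IsRegular : Prop where
  nonempty : Nonempty (Fin N)
  p_nonneg : ∀ i j, 0 ≤ S.p i j
  p_sum : ∀ i, ∑ j, S.p i j = 1
  posDef_Q : ∀ i, (S.Q i).PosDef
  posDef_R : ∀ i, (S.R i).PosDef

/-- The closed-loop matrices `A i - B i * K i`. -/
def closedLoop (K : MatTuple N k d) : MatTuple N d d := fun i => S.A i - S.B i * K i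

/-- The operator propagating the mode-wise second moments by one step. -/
def forward (K : MatTuple N k d) : MatTuple N d d →ₗ[ℝ] MatTuple N d d where
  toFun X j := ∑ i, S.p i j • (S.closedLoop K i * X i * (S.closedLoop K i)ᵀ)
  map_add' X Y := by
    ext1 j
    simp [Matrix.mul_add, Matrix.add_mul, Finset.sum_add_distrib]
  map_smul' c X := by
    ext1 j
    simp [Finset.smul_sum, smul_comm c]

theorem E_add (V V' : MatTuple N d d) : S.E (V + V') = S.E V + S.E V' := by
  ext1 i
  simp [E, Finset.sum_add_distrib]

theorem E_smul (c : ℝ) (V : MatTuple N d d) : S.E (c • V) = c • S.E V := by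
  ext1 i
  simp [E, Finset.smul_sum, smul_comm c]

theorem E_sub (V V' : MatTuple N d d) : S.E (V - V') = S.E V - S.E V' := by
  ext1 i
  simp [E, smul_sub, Finset.sum_sub_distrib]

/-- The adjoint of `forward`, propagating quadratic cost-to-go functions by one step. -/
def backward (K : MatTuple N k d) : MatTuple N d d →ₗ[ℝ] MatTuple N d d where
  toFun V i := (S.closedLoop K i)ᵀ * S.E V i * S.closedLoop K i
  map_add' V V' := by
    ext1 i
    simp [E_add, Matrix.mul_add, Matrix.add_mul]
  map_smul' c V := by
    ext1 i
    simp [E_smul]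

theorem backward_apply (K : MatTuple N k d) (V : MatTuple N d d) (i : Fin N) :
    S.backward K V i = (S.closedLoop K i)ᵀ * S.E V i * S.closedLoop K i := rfl

theorem forward_apply (K : MatTuple N k d) (X : MatTuple N d d) (j : Fin N) :
    S.forward K X j = ∑ i, S.p i j • (S.closedLoop K i * X i * (S.closedLoop K i)ᵀ) := rfl

/-- The quadratic form `Q i + (K i)ᵀ R i K i` of the stage cost under the feedback `K`. -/
def runningCost (K : MatTuple N k d) : MatTuple N d d := fun i =>
  S.Q i + (K i)ᵀ * S.R i * K i

theorem pairing_forward (K : MatTuple N k d) (X V : MatTuple N d d) :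
    pairing (S.forward K X) V = pairing X (S.backward K V) := by
  simp only [pairing_apply, forward_apply, backward_apply, E, Finset.sum_mul, trace_sum,
    Finset.mul_sum, Matrix.smul_mul, Matrix.mul_smul, trace_smul]
  rw [Finset.sum_comm]
  refine Finset.sum_congr rfl fun i _ => Finset.sum_congr rfl fun j _ => ?_
  congr 1
  rw [Matrix.mul_assoc (S.closedLoop K i * X i), Matrix.mul_assoc (S.closedLoop K i),
    trace_mul_comm]
  simp only [Matrix.mul_assoc]

theorem pairing_forward_pow (K : MatTuple N k d) (t : ℕ) (X V : MatTuple N d d) :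
    pairing ((S.forward K ^ t) X) V = pairing X ((S.backward K ^ t) V) := by
  induction t generalizing X with
  | zero => simp
  | succ t ih =>
    rw [pow_succ, Module.End.mul_apply, ih, pairing_forward, pow_succ', Module.End.mul_apply]

variable {S}

namespace IsRegular

variable (h : S.IsRegular)
include h

theorem Q_nonneg : 0 ≤ S.Q := fun i => (h.posDef_Q i).posSemidef.nonneg

theorem R_nonneg : 0 ≤ S.R := fun i => (h.posDef_R i).posSemidef.nonneg

theorem exists_smul_one_le_Q : ∃ q : ℝ, 0 < q ∧ q • (1 : MatTuple N d d) ≤ S.Q := by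
  have := h.nonempty
  exact exists_pos_smul_one_le h.posDef_Q

theorem exists_smul_one_le_R : ∃ r : ℝ, 0 < r ∧ r • (1 : MatTuple N k k) ≤ S.R := by
  have := h.nonempty
  exact exists_pos_smul_one_le h.posDef_R

theorem E_nonneg {V : MatTuple N d d} (hV : 0 ≤ V) : 0 ≤ S.E V := fun i =>
  Finset.sum_nonneg fun j _ => smul_nonneg (h.p_nonneg i j) (hV j)

theorem E_mono : Monotone S.E := fun V V' hV => by
  rw [← sub_nonneg] at hV ⊢
  rw [← E_sub]
  exact h.E_nonneg hV

theorem E_one : S.E 1 = 1 := by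
  ext1 i
  simp [E, ← Finset.sum_smul, h.p_sum i]

theorem E_le_smul_one {V : MatTuple N d d} {c : ℝ} (hV : V ≤ c • 1) : S.E V ≤ c • 1 := by
  have := h.E_mono hV
  rwa [E_smul, h.E_one] at this

theorem backward_mono (K : MatTuple N k d) : Monotone (S.backward K) := fun _ _ hV i =>
  transpose_mul_mul_mono (h.E_mono hV i) _

theorem backward_nonneg (K : MatTuple N k d) {V : MatTuple N d d} (hV : 0 ≤ V) :
    0 ≤ S.backward K V := by
  simpa using h.backward_mono K hV

theorem forward_nonneg (K : MatTuple N k d) {X : MatTuple N d d} (hX : 0 ≤ X) :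
    0 ≤ S.forward K X := fun j => by
  rw [forward_apply]
  exact Finset.sum_nonneg fun i _ => smul_nonneg (h.p_nonneg i j)
    (mul_mul_transpose_nonneg (hX i) (S.closedLoop K i))

theorem backward_pow_nonneg (K : MatTuple N k d) {V : MatTuple N d d} (hV : 0 ≤ V) (t : ℕ) :
    0 ≤ (S.backward K ^ t) V :=
  pow_apply_nonneg (fun _ => h.backward_nonneg K) hV t

theorem forward_pow_nonneg (K : MatTuple N k d) {X : MatTuple N d d} (hX : 0 ≤ X) (t : ℕ) :
    0 ≤ (S.forward K ^ t) X :=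
  pow_apply_nonneg (fun _ => h.forward_nonneg K) hX t

theorem Q_le_runningCost (K : MatTuple N k d) : S.Q ≤ S.runningCost K := fun i =>
  le_add_of_nonneg_right (transpose_mul_mul_nonneg (h.R_nonneg i) _)

theorem runningCost_nonneg (K : MatTuple N k d) : 0 ≤ S.runningCost K :=
  h.Q_nonneg.trans (h.Q_le_runningCost K)

end IsRegular

variable (S)

/-- Existence of a quadratic Lyapunov function for the closed loop. For regular data it is
equivalent to mean-square stability. -/
def Stable (K : MatTuple N k d) : Prop :=
  ∃ P : MatTuple N d d, 0 ≤ P ∧ S.Q + S.backward K P ≤ P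

/-- The cost-to-go `∑ₜ (backward K)^t (Q + Kᵀ R K)`: for a stable gain, `vᵀ (value K i) v` is the
cost of the closed loop started from the state `v` in the mode `i`. -/
def value (K : MatTuple N k d) : MatTuple N d d :=
  ∑' t, (S.backward K ^ t) (S.runningCost K)

/-- The accumulated mode-wise second moments `∑ₜ (forward K)^t X₀` of the closed loop whose
initial mode-wise second moments are `X₀`. -/
def totalCov (X₀ : MatTuple N d d) (K : MatTuple N k d) : MatTuple N d d :=
  ∑' t, (S.forward K ^ t) X₀

variable {S}

theorem IsRegular.value_nonneg (h : S.IsRegular) (K : MatTuple N k d) : 0 ≤ S.value K :=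
  tsum_nonneg fun t => h.backward_pow_nonneg K (h.runningCost_nonneg K) t

theorem IsRegular.totalCov_nonneg (h : S.IsRegular) {X₀ : MatTuple N d d} (hX : 0 ≤ X₀)
    (K : MatTuple N k d) : 0 ≤ S.totalCov X₀ K :=
  tsum_nonneg fun t => h.forward_pow_nonneg K hX t

theorem exists_add_backward_le {K : MatTuple N k d} {P Y Z : MatTuple N d d} (hP : 0 ≤ P)
    (hY : 0 ≤ Y) {c : ℝ} (hc : 0 < c) (hZ : c • 1 ≤ Z) (hle : Z + S.backward K P ≤ P) :
    ∃ P' : MatTuple N d d, 0 ≤ P' ∧ Y + S.backward K P' ≤ P' := by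
  obtain ⟨a, ha, hYZ⟩ := exists_le_smul_of_smul_one_le hY hc hZ
  refine ⟨a • P, smul_nonneg ha hP, (add_le_add hYZ le_rfl).trans ?_⟩
  rw [map_smul, ← smul_add]
  exact smul_le_smul_of_nonneg_left hle ha

theorem Stable.of_add_backward_le (h : S.IsRegular) {K : MatTuple N k d} {P Y : MatTuple N d d}
    (hP : 0 ≤ P) {c : ℝ} (hc : 0 < c) (hY : c • 1 ≤ Y) (hle : Y + S.backward K P ≤ P) :
    S.Stable K :=
  exists_add_backward_le hP h.Q_nonneg hc hY hle

namespace Stable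

section Series

variable (h : S.IsRegular) {K : MatTuple N k d} (hK : S.Stable K)
include h hK

theorem summable_backward {Y : MatTuple N d d} (hY : 0 ≤ Y) :
    Summable fun t => (S.backward K ^ t) Y := by
  obtain ⟨P, hP, hle⟩ := hK
  obtain ⟨q, hq, hqQ⟩ := h.exists_smul_one_le_Q
  obtain ⟨P', hP', hle'⟩ := exists_add_backward_le hP hY hq hqQ hle
  refine summable_of_sum_pairing_one_le (c := pairing P' 1)
    (h.backward_pow_nonneg K hY) fun n => ?_
  rw [← LinearMap.sum_apply, ← map_sum]
  exact pairing_mono_left one_nonneg (sum_pow_apply_le (h.backward_mono K) hP' hle' n)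

theorem tendsto_backward {Y : MatTuple N d d} (hY : 0 ≤ Y) :
    Tendsto (fun t => (S.backward K ^ t) Y) atTop (𝓝 0) :=
  (hK.summable_backward h hY).tendsto_atTop_zero

theorem summable_forward {X : MatTuple N d d} (hX : 0 ≤ X) :
    Summable fun t => (S.forward K ^ t) X := by
  have hs := hK.summable_backward h one_nonneg
  refine summable_of_sum_pairing_one_le (c := pairing X (∑' t, (S.backward K ^ t) 1))
    (h.forward_pow_nonneg K hX) fun n => ?_
  simp only [pairing_forward_pow]
  rw [← map_sum]
  exact pairing_mono_right hX
    (hs.sum_le_tsum _ fun t _ => h.backward_pow_nonneg K one_nonneg t)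

theorem le_of_backward_sub_le {U V : MatTuple N d d} (hU : 0 ≤ U) (hV : 0 ≤ V)
    (hle : S.backward K (V - U) ≤ V - U) : U ≤ V := by
  have hpow (t : ℕ) : (S.backward K ^ t) (V - U) ≤ V - U := by
    induction t with
    | zero => rw [pow_zero, Module.End.one_apply]
    | succ t ih =>
      rw [pow_succ', Module.End.mul_apply]
      exact (h.backward_mono K ih).trans hle
  have hlim : Tendsto (fun t => (S.backward K ^ t) (V - U)) atTop (𝓝 0) := by
    simpa only [map_sub, sub_zero] using (hK.tendsto_backward h hV).sub (hK.tendsto_backward h hU)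
  exact sub_nonneg.1 (le_of_tendsto' hlim hpow)

theorem value_eq : S.value K = S.runningCost K + S.backward K (S.value K) :=
  tsum_pow_apply_eq_add _ (hK.summable_backward h (h.runningCost_nonneg K))

theorem totalCov_eq {X₀ : MatTuple N d d} (hX : 0 ≤ X₀) :
    S.totalCov X₀ K = X₀ + S.forward K (S.totalCov X₀ K) :=
  tsum_pow_apply_eq_add _ (hK.summable_forward h hX)

theorem runningCost_le_value : S.runningCost K ≤ S.value K := by
  conv_rhs => rw [hK.value_eq h]
  exact le_add_of_nonneg_right (h.backward_nonneg K (h.value_nonneg K))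

theorem Q_le_value : S.Q ≤ S.value K :=
  (h.Q_le_runningCost K).trans (hK.runningCost_le_value h)

theorem le_totalCov {X₀ : MatTuple N d d} (hX : 0 ≤ X₀) : X₀ ≤ S.totalCov X₀ K := by
  conv_rhs => rw [hK.totalCov_eq h hX]
  exact le_add_of_nonneg_right (h.forward_nonneg K (h.totalCov_nonneg hX K))

theorem pairing_totalCov {X₀ : MatTuple N d d} (hX : 0 ≤ X₀) (Z : MatTuple N d d) :
    pairing (S.totalCov X₀ K) (Z - S.backward K Z) = pairing X₀ Z := by
  rw [map_sub, ← pairing_forward, ← LinearMap.sub_apply, ← map_sub]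
  nth_rw 1 [hK.totalCov_eq h hX]
  rw [add_sub_cancel_right]

theorem pairing_value {X₀ : MatTuple N d d} (hX : 0 ≤ X₀) :
    pairing X₀ (S.value K) = pairing (S.totalCov X₀ K) (S.runningCost K) := by
  rw [← hK.pairing_totalCov h hX]
  congr 1
  exact sub_eq_of_eq_add (hK.value_eq h)

theorem eq_value {P : MatTuple N d d} (hP : 0 ≤ P)
    (heq : P = S.runningCost K + S.backward K P) : P = S.value K := by
  have hfixed : S.backward K (P - S.value K) = P - S.value K := by
    conv_rhs => rw [heq, hK.value_eq h]
    rw [map_sub, add_sub_add_left_eq_sub]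
  refine le_antisymm (hK.le_of_backward_sub_le h hP (h.value_nonneg K) (le_of_eq ?_))
    (hK.le_of_backward_sub_le h (h.value_nonneg K) hP hfixed.le)
  rw [← neg_sub, map_neg, hfixed]

theorem value_le {P : MatTuple N d d} (hP : 0 ≤ P)
    (hle : S.runningCost K + S.backward K P ≤ P) : S.value K ≤ P := by
  refine hK.le_of_backward_sub_le h (h.value_nonneg K) hP ?_
  nth_rw 2 [hK.value_eq h]
  rw [map_sub, ← sub_sub]
  exact sub_le_sub_right (le_sub_iff_add_le'.2 hle) _

end Series

theorem of_runningCost_add_backward_le (h : S.IsRegular) {K : MatTuple N k d}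
    {P : MatTuple N d d} (hP : 0 ≤ P) (hle : S.runningCost K + S.backward K P ≤ P) : S.Stable K :=
  ⟨P, hP, (add_le_add (h.Q_le_runningCost K) le_rfl).trans hle⟩

theorem of_sum_runningCost_le (h : S.IsRegular) {X₀ : MatTuple N d d} {m : ℝ} (hm : 0 < m)
    (hX : m • 1 ≤ X₀) {K : MatTuple N k d} {α : ℝ}
    (hα : ∀ n, ∑ t ∈ Finset.range n, pairing ((S.forward K ^ t) X₀) (S.runningCost K) ≤ α) :
    S.Stable K ∧ pairing X₀ (S.value K) ≤ α := by
  have hcost := h.runningCost_nonneg K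
  simp only [pairing_forward_pow] at hα
  have hsummable : Summable fun t => (S.backward K ^ t) (S.runningCost K) := by
    refine summable_of_sum_pairing_one_le (c := α / m)
      (h.backward_pow_nonneg K hcost) fun n => ?_
    rw [le_div_iff₀' hm, Finset.mul_sum]
    refine (Finset.sum_le_sum fun t _ => ?_).trans (hα n)
    rw [pairing_comm X₀]
    exact mul_pairing_one_le (h.backward_pow_nonneg K hcost t) hX
  refine ⟨of_runningCost_add_backward_le h (h.value_nonneg K)
    (tsum_pow_apply_eq_add _ hsummable).ge, ?_⟩
  exact le_of_tendsto' (hsummable.hasSum.map (pairing X₀)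
    (continuous_pairing_right X₀)).tendsto_sum_nat hα

end Stable

variable (S)

/-- The weight `R i + (B i)ᵀ ℰ(V) i B i` of the input when the cost-to-go is `V`. -/
def inputWeight (V : MatTuple N d d) : MatTuple N k k := fun i =>
  S.R i + (S.B i)ᵀ * S.E V i * S.B i

/-- Half the derivative in the gain `K` of `runningCost K + backward K V`. -/
def gainResidual (K : MatTuple N k d) (V : MatTuple N d d) : MatTuple N k d := fun i =>
  S.R i * K i - (S.B i)ᵀ * S.E V i * S.closedLoop K i

/-- The symmetrized product `Dᵀ M + Mᵀ D`, in which the derivatives of quadratic forms are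
expressed. -/
def symProd (D M : MatTuple N k d) : MatTuple N d d := fun i => (D i)ᵀ * M i + (M i)ᵀ * D i

/-- The second-order part of `runningCost K + backward K V` under a change `D` of the gain `K`. -/
def curvature (D : MatTuple N k d) (V : MatTuple N d d) : MatTuple N d d := fun i =>
  (D i)ᵀ * S.inputWeight V i * D i

/-- The joint effect of a change `D` of the gain and a change `G` of the expected cost-to-go. -/
def crossTerm (K D : MatTuple N k d) (G : MatTuple N d d) : MatTuple N d d := fun i =>
  (S.B i * D i)ᵀ * G i * S.closedLoop K i + (S.closedLoop K i)ᵀ * G i * (S.B i * D i)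

/-- The cost of a stable gain for the initial mode-wise second moments `X₀`. -/
def quadCost (X₀ : MatTuple N d d) (K : MatTuple N k d) : ℝ := pairing X₀ (S.value K)

/-- The stable gains of cost at most `α`. -/
def sublevel (X₀ : MatTuple N d d) (α : ℝ) : Set (MatTuple N k d) :=
  {K | S.Stable K ∧ S.quadCost X₀ K ≤ α}

/-- The gradient of `quadCost X₀` for the Frobenius inner product. -/
def costGradient (X₀ : MatTuple N d d) (K : MatTuple N k d) : MatTuple N k d := fun i =>
  (2 : ℝ) • (S.gainResidual K (S.value K) i * S.totalCov X₀ K i)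

theorem crossTerm_neg (K D : MatTuple N k d) (G : MatTuple N d d) :
    S.crossTerm K D (-G) = -S.crossTerm K D G := by
  ext1 i
  simp only [crossTerm, Pi.neg_apply, Matrix.mul_neg, Matrix.neg_mul, neg_add]

theorem pairing_symProd {X : MatTuple N d d} (hX : ∀ i, (X i)ᵀ = X i) (D M : MatTuple N k d) :
    pairing X (symProd D M) = frobInner (fun i => (2 : ℝ) • (M i * X i)) D := by
  rw [pairing_apply, frobInner_apply]
  refine Finset.sum_congr rfl fun i _ => ?_
  have hleft : (X i * ((D i)ᵀ * M i)).trace = (X i * ((M i)ᵀ * D i)).trace := by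
    rw [← trace_transpose, transpose_mul, transpose_mul, transpose_transpose, hX, trace_mul_comm]
  rw [symProd, Matrix.mul_add, trace_add, hleft, transpose_smul, transpose_mul, hX,
    Matrix.smul_mul, trace_smul, smul_eq_mul, two_mul, Matrix.mul_assoc]

variable {S}

theorem IsRegular.inputWeight_nonneg (h : S.IsRegular) {V : MatTuple N d d} (hV : 0 ≤ V) :
    0 ≤ S.inputWeight V := fun i =>
  add_nonneg (h.R_nonneg i) (transpose_mul_mul_nonneg (h.E_nonneg hV i) _)

theorem IsRegular.R_le_inputWeight (h : S.IsRegular) {V : MatTuple N d d} (hV : 0 ≤ V) :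
    S.R ≤ S.inputWeight V := fun i =>
  le_add_of_nonneg_right (transpose_mul_mul_nonneg (h.E_nonneg hV i) _)

theorem IsRegular.curvature_nonneg (h : S.IsRegular) (D : MatTuple N k d) {V : MatTuple N d d}
    (hV : 0 ≤ V) : 0 ≤ S.curvature D V := fun i =>
  transpose_mul_mul_nonneg (h.inputWeight_nonneg hV i) _

theorem IsRegular.bellman_sub (h : S.IsRegular) (K K' : MatTuple N k d) {V : MatTuple N d d}
    (hV : 0 ≤ V) :
    S.runningCost K' + S.backward K' V - (S.runningCost K + S.backward K V)
      = symProd (K' - K) (S.gainResidual K' V) - S.curvature (K' - K) V := by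
  ext1 i
  simp only [Pi.sub_apply, Pi.add_apply, runningCost, backward_apply, symProd, curvature,
    inputWeight, gainResidual, closedLoop, transpose_sub, transpose_mul, transpose_transpose,
    transpose_eq_of_nonneg (h.E_nonneg hV i), transpose_eq_of_nonneg (h.R_nonneg i),
    Matrix.mul_sub, Matrix.sub_mul, Matrix.add_mul, Matrix.mul_add, Matrix.mul_assoc]
  abel

theorem IsRegular.symProd_gainResidual_sub_curvature (h : S.IsRegular) (K K' : MatTuple N k d)
    {V V' : MatTuple N d d} (hV : 0 ≤ V) (hV' : 0 ≤ V') :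
    symProd (K' - K) (S.gainResidual K' V') - S.curvature (K' - K) V'
      = symProd (K' - K) (S.gainResidual K V) + S.curvature (K' - K) V'
        - S.crossTerm K (K' - K) (S.E (V' - V)) := by
  ext1 i
  simp only [E_sub, Pi.sub_apply, Pi.add_apply, symProd, curvature, crossTerm, inputWeight,
    gainResidual, closedLoop, transpose_sub, transpose_mul, transpose_transpose,
    transpose_eq_of_nonneg (h.E_nonneg hV i), transpose_eq_of_nonneg (h.E_nonneg hV' i),
    transpose_eq_of_nonneg (h.R_nonneg i), Matrix.mul_sub, Matrix.sub_mul, Matrix.add_mul,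
    Matrix.mul_add, Matrix.mul_assoc]
  abel

theorem IsRegular.quadCost_nonneg (h : S.IsRegular) {X₀ : MatTuple N d d} (hX : 0 ≤ X₀)
    (K : MatTuple N k d) : 0 ≤ S.quadCost X₀ K :=
  pairing_nonneg hX (h.value_nonneg K)

namespace Stable

variable (h : S.IsRegular) {K K' : MatTuple N k d} (hK : S.Stable K) (hK' : S.Stable K')
include h hK

theorem symProd_gainResidual_le (D : MatTuple N k d) {w : ℝ} (hw : 0 < w) :
    symProd D (S.gainResidual K (S.value K))
      ≤ w • (S.value K - S.Q) + w⁻¹ • S.curvature D (S.value K) := fun i => by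
  have hE := h.E_nonneg (h.value_nonneg K) i
  have hyoung := add_le_add (young_of_nonneg (h.R_nonneg i) (K i) (D i) hw)
    (young_of_nonneg hE (S.closedLoop K i) (-(S.B i * D i)) hw)
  have hvalue : S.value K i - S.Q i
      = (K i)ᵀ * S.R i * K i + (S.closedLoop K i)ᵀ * S.E (S.value K) i * S.closedLoop K i := by
    rw [congrFun (hK.value_eq h) i, Pi.add_apply, backward_apply, runningCost]
    abel
  simp only [Pi.add_apply, Pi.smul_apply, Pi.sub_apply, hvalue]
  refine Eq.trans_le ?_ (hyoung.trans_eq ?_)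
  · simp only [symProd, gainResidual, transpose_sub, transpose_mul, transpose_transpose,
      transpose_eq_of_nonneg hE, transpose_eq_of_nonneg (h.R_nonneg i), transpose_neg,
      Matrix.mul_neg, Matrix.neg_mul, Matrix.mul_sub, Matrix.sub_mul, Matrix.mul_assoc]
    abel
  · simp only [curvature, inputWeight, transpose_mul, transpose_neg, Matrix.mul_neg,
      Matrix.neg_mul, neg_neg, Matrix.add_mul, Matrix.mul_add, Matrix.mul_assoc, smul_add]
    abel

theorem value_sub_backward_value : S.value K - S.backward K (S.value K) = S.runningCost K :=
  sub_eq_of_eq_add (hK.value_eq h)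

include hK'

theorem value_sub_value :
    S.value K' - S.value K - S.backward K (S.value K' - S.value K)
      = symProd (K' - K) (S.gainResidual K' (S.value K')) - S.curvature (K' - K) (S.value K') := by
  rw [← h.bellman_sub K K' (h.value_nonneg K'), ← hK'.value_eq h, map_sub,
    ← hK.value_sub_backward_value h]
  abel

theorem quadCost_sub_quadCost {X₀ : MatTuple N d d} (hX : 0 ≤ X₀) :
    S.quadCost X₀ K' - S.quadCost X₀ K
      = pairing (S.totalCov X₀ K)
        (symProd (K' - K) (S.gainResidual K' (S.value K'))
          - S.curvature (K' - K) (S.value K')) := by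
  rw [← hK.value_sub_value h hK', hK.pairing_totalCov h hX, map_sub, quadCost, quadCost]

theorem quadCost_sub_sub_frobInner {X₀ : MatTuple N d d} (hX : 0 ≤ X₀) :
    S.quadCost X₀ K' - S.quadCost X₀ K - frobInner (S.costGradient X₀ K) (K' - K)
      = pairing (S.totalCov X₀ K) (S.curvature (K' - K) (S.value K'))
        - pairing (S.totalCov X₀ K)
          (S.crossTerm K (K' - K) (S.E (S.value K' - S.value K))) := by
  have hgrad : pairing (S.totalCov X₀ K) (symProd (K' - K) (S.gainResidual K (S.value K)))
      = frobInner (S.costGradient X₀ K) (K' - K) :=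
    pairing_symProd (fun i => transpose_eq_of_nonneg (h.totalCov_nonneg hX K i)) _ _
  rw [hK.quadCost_sub_quadCost h hK' hX, h.symProd_gainResidual_sub_curvature K K'
    (h.value_nonneg K) (h.value_nonneg K'), map_sub, map_add, hgrad]
  ring

theorem value_sub_le_smul {c : ℝ} (hc : 0 ≤ c)
    (hle : symProd (K' - K) (S.gainResidual K' (S.value K')) ≤ c • S.Q) :
    S.value K' - S.value K ≤ c • S.value K := by
  have hv := h.value_nonneg K
  have hv' := h.value_nonneg K'
  rw [sub_le_iff_le_add']
  refine hK.le_of_backward_sub_le h hv' (add_nonneg hv (smul_nonneg hc hv)) ?_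
  have hcurv := h.curvature_nonneg (K' - K) hv'
  have hQ := smul_le_smul_of_nonneg_left (h.Q_le_runningCost K) hc
  have hdiff : S.value K' - S.value K - S.backward K (S.value K' - S.value K)
      ≤ c • (S.value K - S.backward K (S.value K)) := by
    rw [hK.value_sub_value h hK', hK.value_sub_backward_value h]
    exact (sub_le_self _ hcurv).trans (hle.trans hQ)
  rw [← sub_nonneg] at hdiff ⊢
  refine hdiff.trans_eq ?_
  simp only [map_sub, map_add, map_smul, smul_sub]
  abel

end Stable

theorem le_two_mul_of_forall_le_mul_add_inv {x c s : ℝ} (hc : 0 ≤ c) (hs : 0 ≤ s)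
    (h : ∀ w : ℝ, 0 < w → x ≤ c * (w * s ^ 2 + w⁻¹)) : x ≤ 2 * c * s := by
  have hlim : Tendsto (fun ε => c * (s + (s + ε))) (𝓝[>] 0) (𝓝 (c * (s + (s + 0)))) :=
    tendsto_nhdsWithin_of_tendsto_nhds (Continuous.tendsto (by fun_prop) 0)
  refine (ge_of_tendsto hlim ?_).trans_eq (by ring)
  filter_upwards [self_mem_nhdsWithin] with ε (hε : 0 < ε)
  refine (h (s + ε)⁻¹ (by positivity)).trans ?_
  rw [inv_inv]
  gcongr
  rw [inv_mul_le_iff₀ (by positivity)]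
  nlinarith

section CrossTerm

variable (h : S.IsRegular) {b c : ℝ} (hB : ∀ i, (S.B i)ᵀ * S.B i ≤ b ^ 2 • 1)
  {G : MatTuple N d d} (hneg : -G ≤ c • 1) (hle : G ≤ c • 1)
include h hB hneg hle

theorem crossTerm_le (hc : 0 ≤ c) (K D : MatTuple N k d) {w : ℝ} (hw : 0 < w) :
    S.crossTerm K D G ≤ c • (w • (b ^ 2 * frobSq D) • 1 + w⁻¹ • S.backward K 1) := fun i => by
  have hBD : (S.B i * D i)ᵀ * (S.B i * D i) ≤ (b ^ 2 * frobSq D) • 1 := by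
    refine Eq.trans_le ?_ ((transpose_mul_self_le_smul (hB i) (D i)).trans ?_)
    · simp only [transpose_mul, Matrix.mul_assoc]
    · rw [mul_smul]
      exact smul_le_smul_of_nonneg_left (transpose_mul_self_le_frobSq D i) (sq_nonneg b)
  refine (young_of_neg_le_of_le (hneg i) (hle i) (S.B i * D i) (S.closedLoop K i) hw).trans ?_
  simp only [Pi.smul_apply, Pi.add_apply, backward_apply, h.E_one, Pi.one_apply, Matrix.mul_one]
  gcongr

theorem Stable.pairing_crossTerm_le (hb : 0 ≤ b) (hc : 0 ≤ c) {K : MatTuple N k d}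
    (hK : S.Stable K) {X₀ : MatTuple N d d} (hX : 0 ≤ X₀) (D : MatTuple N k d) :
    pairing (S.totalCov X₀ K) (S.crossTerm K D G)
      ≤ 2 * (c * pairing (S.totalCov X₀ K) 1) * (b * √(frobSq D)) := by
  set X := S.totalCov X₀ K with hXdef
  have hX' : 0 ≤ X := h.totalCov_nonneg hX K
  have hτ : 0 ≤ pairing X 1 := pairing_nonneg hX' one_nonneg
  have hnext : pairing X (S.backward K 1) ≤ pairing X 1 := by
    rw [← pairing_forward]
    refine pairing_mono_left one_nonneg ?_
    conv_rhs => rw [hXdef, hK.totalCov_eq h hX]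
    exact le_add_of_nonneg_left hX
  refine le_two_mul_of_forall_le_mul_add_inv (by positivity) (by positivity) fun w hw => ?_
  have hpair := pairing_mono_right hX' (crossTerm_le h hB hneg hle hc K D hw)
  simp only [map_smul, map_add, smul_eq_mul] at hpair
  calc pairing X (S.crossTerm K D G)
      ≤ c * (w * (b ^ 2 * frobSq D * pairing X 1) + w⁻¹ * pairing X 1) := hpair.trans (by gcongr)
    _ = c * pairing X 1 * (w * (b * √(frobSq D)) ^ 2 + w⁻¹) := by
      rw [mul_pow, Real.sq_sqrt (frobSq_nonneg D)]
      ring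

theorem Stable.abs_pairing_crossTerm_le (hb : 0 ≤ b) (hc : 0 ≤ c) {K : MatTuple N k d}
    (hK : S.Stable K) {X₀ : MatTuple N d d} (hX : 0 ≤ X₀) (D : MatTuple N k d) :
    |pairing (S.totalCov X₀ K) (S.crossTerm K D G)|
      ≤ 2 * (c * pairing (S.totalCov X₀ K) 1) * (b * √(frobSq D)) := by
  refine abs_le'.2 ⟨hK.pairing_crossTerm_le h hB hneg hle hb hc hX D, ?_⟩
  rw [← map_neg, ← crossTerm_neg]
  exact hK.pairing_crossTerm_le h hB ((neg_neg G).trans_le hle) hneg hb hc hX D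

end CrossTerm

/-- Scalar bounds on the data, in terms of which the convergence rates are expressed: `m` and `q`
are lower bounds for `X₀` and `Q`, `ρ` is an upper bound for `R`, and `b` one for the spectral
norm of `B`. -/
structure IsBounded (S : MJLS N d k) (X₀ : MatTuple N d d) (m q ρ b : ℝ) : Prop where
  m_pos : 0 < m
  q_pos : 0 < q
  ρ_nonneg : 0 ≤ ρ
  b_nonneg : 0 ≤ b
  le_initial : m • 1 ≤ X₀
  le_Q : q • 1 ≤ S.Q
  R_le : S.R ≤ ρ • 1
  B_le : ∀ i, (S.B i)ᵀ * S.B i ≤ b ^ 2 • 1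

theorem IsRegular.value_le_smul_one (h : S.IsRegular) {X₀ : MatTuple N d d} {m α : ℝ}
    (hm : 0 < m) (hX : m • 1 ≤ X₀) {K : MatTuple N k d} (hα : S.quadCost X₀ K ≤ α) :
    S.value K ≤ (α / m) • 1 := by
  have hv := h.value_nonneg K
  refine (le_pairing_one_smul_one hv).trans (smul_le_smul_of_nonneg_right ?_ one_nonneg)
  rw [le_div_iff₀' hm]
  exact (mul_pairing_one_le hv hX).trans (by rwa [pairing_comm])

theorem Stable.pairing_totalCov_one_le (h : S.IsRegular) {X₀ : MatTuple N d d} {q α : ℝ}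
    (hX : 0 ≤ X₀) (hq : 0 < q) (hQ : q • 1 ≤ S.Q) {K : MatTuple N k d} (hK : S.Stable K)
    (hα : S.quadCost X₀ K ≤ α) : pairing (S.totalCov X₀ K) 1 ≤ α / q := by
  rw [le_div_iff₀' hq]
  refine (mul_pairing_one_le (h.totalCov_nonneg hX K)
    (hQ.trans (h.Q_le_runningCost K))).trans ?_
  rwa [← hK.pairing_value h hX]

namespace IsBounded

variable (h : S.IsRegular) {X₀ : MatTuple N d d} {m q ρ b α : ℝ}
  (hbd : S.IsBounded X₀ m q ρ b)
include hbd

theorem initial_nonneg : 0 ≤ X₀ := nonneg_of_smul_one_le hbd.m_pos.le hbd.le_initial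

include h

theorem curvature_le (D : MatTuple N k d) {V : MatTuple N d d} {c : ℝ} (hc : 0 ≤ c)
    (hV : V ≤ c • 1) : S.curvature D V ≤ ((ρ + b ^ 2 * c) * frobSq D) • 1 := fun i => by
  have hweight : S.inputWeight V i ≤ (ρ + b ^ 2 * c) • 1 := by
    rw [add_smul, mul_comm, mul_smul]
    exact add_le_add (hbd.R_le i) ((transpose_mul_self_le_smul (h.E_le_smul_one hV i) _).trans
      (smul_le_smul_of_nonneg_left (hbd.B_le i) hc))
  have hρ := hbd.ρ_nonneg
  refine (transpose_mul_self_le_smul hweight (D i)).trans ?_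
  rw [Pi.smul_apply, mul_smul]
  exact smul_le_smul_of_nonneg_left (transpose_mul_self_le_frobSq D i) (by positivity)

variable {ξ : ℝ} (hξ : 0 ≤ ξ) (hξq : α / m - q + (ρ + b ^ 2 * (α / m)) ≤ q * ξ)
  {K K' : MatTuple N k d} (hK : K ∈ S.sublevel X₀ α) (hK' : K' ∈ S.sublevel X₀ α)
include hξ hξq hK hK'

theorem value_sub_le :
    S.value K' - S.value K ≤ (√(frobSq (K' - K)) * ξ * (α / m)) • 1 := by
  have hv'α := h.value_le_smul_one hbd.m_pos hbd.le_initial hK'.2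
  have hα : 0 ≤ α := (h.quadCost_nonneg hbd.initial_nonneg K).trans hK.2
  have hm := hbd.m_pos
  rcases (frobSq_nonneg (K' - K)).eq_or_lt with hzero | hpos
  · rw [sub_eq_zero.1 (frobSq_eq_zero.1 hzero.symm), sub_self]
    exact smul_nonneg (by positivity) one_nonneg
  set f := √(frobSq (K' - K)) with hf
  have hf_pos : 0 < f := Real.sqrt_pos.2 hpos
  have hcurv := hbd.curvature_le h (K' - K) (by positivity) hv'α
  have hsym : symProd (K' - K) (S.gainResidual K' (S.value K')) ≤ (f * ξ) • S.Q := calc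
    _ ≤ f • ((α / m) • 1 - q • 1)
        + f⁻¹ • (((ρ + b ^ 2 * (α / m)) * frobSq (K' - K)) • (1 : MatTuple N d d)) :=
      (hK'.1.symProd_gainResidual_le h (K' - K) hf_pos).trans <| add_le_add
        (smul_le_smul_of_nonneg_left (sub_le_sub hv'α hbd.le_Q) hf_pos.le)
        (smul_le_smul_of_nonneg_left hcurv (inv_nonneg.2 hf_pos.le))
    _ = (f * (α / m - q + (ρ + b ^ 2 * (α / m)))) • 1 := by
      rw [← Real.sq_sqrt hpos.le, ← hf]
      match_scalars
      field_simp
    _ ≤ (f * (q * ξ)) • 1 := smul_le_smul_of_nonneg_right (by gcongr) one_nonneg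
    _ = (f * ξ) • q • 1 := by module
    _ ≤ (f * ξ) • S.Q := smul_le_smul_of_nonneg_left hbd.le_Q (by positivity)
  refine (hK.1.value_sub_le_smul h hK'.1 (by positivity) hsym).trans ?_
  rw [mul_smul (f * ξ)]
  exact smul_le_smul_of_nonneg_left
    (h.value_le_smul_one hbd.m_pos hbd.le_initial hK.2) (by positivity)

theorem abs_quadCost_sub_sub_frobInner_le :
    |S.quadCost X₀ K' - S.quadCost X₀ K - frobInner (S.costGradient X₀ K) (K' - K)|
      ≤ (ρ + (b ^ 2 + 2 * ξ * b) * (α / m)) * (α / q) * frobSq (K' - K) := by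
  have hX := hbd.initial_nonneg
  have hα : 0 ≤ α := (h.quadCost_nonneg hX K).trans hK.2
  have hm := hbd.m_pos
  have hq := hbd.q_pos
  have hρ := hbd.ρ_nonneg
  have hb := hbd.b_nonneg
  have hXn := h.totalCov_nonneg hX K
  have hτ := hK.1.pairing_totalCov_one_le h hX hq hbd.le_Q hK.2
  have hfrob := frobSq_nonneg (K' - K)
  have hle := h.E_le_smul_one (hbd.value_sub_le h hξ hξq hK hK')
  have hneg := h.E_le_smul_one (hbd.value_sub_le h hξ hξq hK' hK)
  rw [← neg_sub (S.value K'), ← neg_one_smul ℝ, E_smul, neg_one_smul, frobSq_sub_comm] at hneg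
  have hcross := hK.1.abs_pairing_crossTerm_le h hbd.B_le hneg hle hb (by positivity) hX (K' - K)
  have hcurv_nonneg := pairing_nonneg hXn (h.curvature_nonneg (K' - K) (h.value_nonneg K'))
  have hcurv := pairing_le_mul_pairing_one hXn (hbd.curvature_le h (K' - K) (by positivity)
    (h.value_le_smul_one hm hbd.le_initial hK'.2))
  rw [hK.1.quadCost_sub_sub_frobInner h hK'.1 hX]
  refine (abs_sub _ _).trans ?_
  rw [abs_of_nonneg hcurv_nonneg]
  set f := √(frobSq (K' - K))
  have hf_sq : f ^ 2 = frobSq (K' - K) := Real.sq_sqrt hfrob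
  calc _ ≤ (ρ + b ^ 2 * (α / m)) * frobSq (K' - K) * (α / q)
        + 2 * (f * ξ * (α / m) * (α / q)) * (b * f) :=
      add_le_add (hcurv.trans (by gcongr)) (hcross.trans (by gcongr))
    _ = _ := by
      rw [← hf_sq]
      ring

end IsBounded

section Continuity

variable (S)

theorem continuous_runningCost : Continuous S.runningCost := by
  unfold runningCost
  fun_prop

theorem continuous_closedLoop : Continuous S.closedLoop := by
  unfold closedLoop
  fun_prop

theorem continuous_backward (V : MatTuple N d d) : Continuous fun K => S.backward K V := by
  have := S.continuous_closedLoop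
  simp only [continuous_pi_iff, backward_apply]
  fun_prop

theorem continuous_forward_pow (X : MatTuple N d d) (t : ℕ) :
    Continuous fun K => (S.forward K ^ t) X := by
  have := S.continuous_closedLoop
  induction t with
  | zero => simpa only [pow_zero, Module.End.one_apply] using continuous_const
  | succ t ih =>
    simp only [pow_succ', Module.End.mul_apply]
    refine continuous_pi fun j => ?_
    simp only [forward_apply]
    fun_prop

theorem continuous_sum_runningCost (X : MatTuple N d d) (n : ℕ) : Continuous fun K =>
    ∑ t ∈ Finset.range n, pairing ((S.forward K ^ t) X) (S.runningCost K) := by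
  have := S.continuous_forward_pow X
  have := S.continuous_runningCost
  simp only [pairing_apply]
  fun_prop

end Continuity

theorem runningCost_add_backward_two_smul_le (h : S.IsRegular) {K : MatTuple N k d}
    {V : MatTuple N d d} (hle : S.runningCost K + S.backward K V - V ≤ (2⁻¹ : ℝ) • S.Q) :
    S.runningCost K + S.backward K ((2 : ℝ) • V) ≤ (2 : ℝ) • V := by
  have htwo := smul_le_smul_of_nonneg_left hle (zero_le_two (α := ℝ))
  rw [smul_inv_smul₀ two_ne_zero] at htwo
  have hcost := htwo.trans (h.Q_le_runningCost K)
  rw [← sub_nonneg] at hcost ⊢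
  refine hcost.trans_eq ?_
  rw [map_smul]
  module

theorem Stable.eventually (h : S.IsRegular) {K : MatTuple N k d} (hK : S.Stable K) :
    ∀ᶠ K' in 𝓝 K, S.Stable K' ∧ S.value K' ≤ (2 : ℝ) • S.value K := by
  obtain ⟨q, hq, hqQ⟩ := h.exists_smul_one_le_Q
  have hv := h.value_nonneg K
  have hsymm (K' : MatTuple N k d) (i : Fin N) :
      ((S.runningCost K' + S.backward K' (S.value K) - S.value K) i)ᵀ
        = (S.runningCost K' + S.backward K' (S.value K) - S.value K) i := by
    have hbellman : 0 ≤ S.runningCost K' + S.backward K' (S.value K) :=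
      add_nonneg (h.runningCost_nonneg K') (h.backward_nonneg K' hv)
    rw [Pi.sub_apply, transpose_sub, transpose_eq_of_nonneg (hv i),
      transpose_eq_of_nonneg (hbellman i)]
  have hlim : Tendsto (fun K' => S.runningCost K' + S.backward K' (S.value K) - S.value K)
      (𝓝 K) (𝓝 0) := by
    have hcont := (S.continuous_runningCost.add (S.continuous_backward (S.value K))).sub
      (continuous_const (y := S.value K))
    have hzero : S.runningCost K + S.backward K (S.value K) - S.value K = 0 :=
      sub_eq_zero.2 (hK.value_eq h).symm
    exact hzero ▸ hcont.tendsto K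
  filter_upwards [eventually_le_smul_one hsymm hlim (by positivity : 0 < 2⁻¹ * q)] with K' hK'
  rw [mul_smul] at hK'
  have hlyapunov := runningCost_add_backward_two_smul_le h
    (hK'.trans (smul_le_smul_of_nonneg_left hqQ (by positivity)))
  have htwo : 0 ≤ (2 : ℝ) • S.value K := smul_nonneg zero_le_two hv
  have hstable := Stable.of_runningCost_add_backward_le h htwo hlyapunov
  exact ⟨hstable, hstable.value_le h htwo hlyapunov⟩

theorem Stable.sum_runningCost_le (h : S.IsRegular) {X₀ : MatTuple N d d} (hX : 0 ≤ X₀)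
    {K : MatTuple N k d} (hK : S.Stable K) (n : ℕ) :
    ∑ t ∈ Finset.range n, pairing ((S.forward K ^ t) X₀) (S.runningCost K)
      ≤ S.quadCost X₀ K := by
  have hcost := h.runningCost_nonneg K
  simp only [pairing_forward_pow]
  rw [← map_sum]
  exact pairing_mono_right hX
    ((hK.summable_backward h hcost).sum_le_tsum _ fun t _ => h.backward_pow_nonneg K hcost t)

theorem IsRegular.exists_isBounded (h : S.IsRegular) {X₀ : MatTuple N d d} {m : ℝ} (hm : 0 < m)
    (hX : m • 1 ≤ X₀) : ∃ q, S.IsBounded X₀ m q (maxNorm S.R) (maxNorm S.B) := by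
  obtain ⟨q, hq, hqQ⟩ := h.exists_smul_one_le_Q
  exact ⟨q, hm, hq, maxNorm_nonneg _, maxNorm_nonneg _, hX, hqQ,
    le_maxNorm_smul_one fun i => transpose_eq_of_nonneg (h.R_nonneg i),
    transpose_mul_self_le_maxNorm_sq S.B⟩

section Sublevel

variable (h : S.IsRegular) {X₀ : MatTuple N d d} {m : ℝ} (hm : 0 < m) (hX : m • 1 ≤ X₀)
include h hm hX

theorem isClosed_sublevel (α : ℝ) : IsClosed (S.sublevel X₀ α) := by
  have hinter : S.sublevel X₀ α = ⋂ n, {K |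
      ∑ t ∈ Finset.range n, pairing ((S.forward K ^ t) X₀) (S.runningCost K) ≤ α} := by
    ext K
    rw [Set.mem_iInter]
    exact ⟨fun hK n => (hK.1.sum_runningCost_le h (nonneg_of_smul_one_le hm.le hX) n).trans hK.2,
      Stable.of_sum_runningCost_le h hm hX⟩
  rw [hinter]
  exact isClosed_iInter fun n =>
    isClosed_le (S.continuous_sum_runningCost X₀ n) continuous_const

theorem Stable.smul_one_le_totalCov {K : MatTuple N k d} (hK : S.Stable K) :
    m • 1 ≤ S.totalCov X₀ K :=
  hX.trans (hK.le_totalCov h (nonneg_of_smul_one_le hm.le hX))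

theorem Stable.mul_frobSq_le_quadCost {K : MatTuple N k d} (hK : S.Stable K) {r : ℝ}
    (hr : 0 ≤ r) (hrR : r • 1 ≤ S.R) : m * r * frobSq K ≤ S.quadCost X₀ K := by
  have hX0 := nonneg_of_smul_one_le hm.le hX
  rw [quadCost, hK.pairing_value h hX0]
  exact (mul_frobSq_le_pairing hm.le hr (hK.smul_one_le_totalCov h hm hX) hrR K).trans
    (pairing_mono_right (h.totalCov_nonneg hX0 K) fun i => le_add_of_nonneg_left (h.Q_nonneg i))

theorem isCompact_sublevel (α : ℝ) : IsCompact (S.sublevel X₀ α) := by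
  obtain ⟨r, hr, hrR⟩ := h.exists_smul_one_le_R
  have hbox : IsCompact (Set.pi Set.univ fun _ => Set.pi Set.univ fun _ => Set.pi Set.univ fun _ =>
      Set.Icc (-√(α / (m * r))) √(α / (m * r)) : Set (MatTuple N k d)) :=
    isCompact_univ_pi fun _ => isCompact_univ_pi fun _ => isCompact_univ_pi fun _ => isCompact_Icc
  refine hbox.of_isClosed_subset (isClosed_sublevel h hm hX α) fun K hK i _ a _ b _ => ?_
  refine Set.mem_Icc.2 (abs_le.1 (Real.abs_le_sqrt ((sq_apply_le_frobSq K i a b).trans ?_)))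
  rw [le_div_iff₀' (by positivity)]
  exact (hK.1.mul_frobSq_le_quadCost h hm hX hr.le hrR).trans hK.2

theorem Stable.exists_eventually_abs_le {K : MatTuple N k d} (hK : S.Stable K) :
    ∃ c : ℝ, 0 ≤ c ∧ ∀ᶠ K' in 𝓝 K, S.Stable K' ∧
      |S.quadCost X₀ K' - S.quadCost X₀ K - frobInner (S.costGradient X₀ K) (K' - K)|
        ≤ c * frobSq (K' - K) := by
  obtain ⟨q, hbd⟩ := h.exists_isBounded hm hX
  have hX0 := hbd.initial_nonneg
  have hq := hbd.q_pos
  have hcost := h.quadCost_nonneg hX0 K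
  set α := 2 * S.quadCost X₀ K with hα
  set ξ := |α / m - q + (maxNorm S.R + maxNorm S.B ^ 2 * (α / m))| / q with hξ
  have hξq : α / m - q + (maxNorm S.R + maxNorm S.B ^ 2 * (α / m)) ≤ q * ξ := by
    rw [hξ, mul_div_cancel₀ _ hq.ne']
    exact le_abs_self _
  have hR := hbd.ρ_nonneg
  have hB := hbd.b_nonneg
  refine ⟨(maxNorm S.R + (maxNorm S.B ^ 2 + 2 * ξ * maxNorm S.B) * (α / m)) * (α / q),
    by positivity, (hK.eventually h).mono fun K' hK' => ⟨hK'.1, ?_⟩⟩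
  have hK'α : S.quadCost X₀ K' ≤ α := by
    simpa only [hα, quadCost, map_smul, smul_eq_mul] using pairing_mono_right hX0 hK'.2
  exact hbd.abs_quadCost_sub_sub_frobInner_le h (by positivity) hξq ⟨hK, by linarith⟩
    ⟨hK'.1, hK'α⟩

theorem Stable.hasFDerivAt {K : MatTuple N k d} (hK : S.Stable K) :
    HasFDerivAt (S.quadCost X₀)
      (frobInner (S.costGradient X₀ K)).toContinuousLinearMap K := by
  obtain ⟨c, hc, hev⟩ := hK.exists_eventually_abs_le h hm hX
  exact hasFDerivAt_of_abs_sub_le_frobSq hc (hev.mono fun K' hK' => hK'.2)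

theorem Stable.eventually_mem_sublevel {K : MatTuple N k d} (hK : S.Stable K) {α : ℝ}
    (hα : S.quadCost X₀ K < α) : ∀ᶠ K' in 𝓝 K, K' ∈ S.sublevel X₀ α := by
  filter_upwards [hK.eventually h,
    (hK.hasFDerivAt h hm hX).continuousAt.eventually_lt continuousAt_const hα] with K' hstable hlt
  exact ⟨hstable.1, hlt.le⟩

theorem Stable.mul_frobSq_gainResidual_le {K : MatTuple N k d} (hK : S.Stable K) :
    4 * m ^ 2 * frobSq (S.gainResidual K (S.value K)) ≤ frobSq (S.costGradient X₀ K) := by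
  have hle := sq_mul_frobSq_le hm.le (hK.smul_one_le_totalCov h hm hX)
    (S.gainResidual K (S.value K))
  have hsmul : S.costGradient X₀ K
      = (2 : ℝ) • fun i => S.gainResidual K (S.value K) i * S.totalCov X₀ K i := rfl
  rw [hsmul, frobSq_smul]
  linarith

theorem exists_stable_gainResidual_eq_zero (hne : ∃ K, S.Stable K) :
    ∃ K, S.Stable K ∧ S.gainResidual K (S.value K) = 0 := by
  obtain ⟨K₀, hK₀⟩ := hne
  obtain ⟨K, hK, hmin⟩ := (isCompact_sublevel h hm hX (S.quadCost X₀ K₀)).exists_isMinOn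
    ⟨K₀, hK₀, le_rfl⟩ fun K hK => (hK.1.hasFDerivAt h hm hX).continuousAt.continuousWithinAt
  have hlocal : IsLocalMin (S.quadCost X₀) K := by
    filter_upwards [hK.1.eventually h] with K' hK'
    rcases le_total (S.quadCost X₀ K') (S.quadCost X₀ K₀) with hle | hle
    · exact hmin ⟨hK'.1, hle⟩
    · exact hK.2.trans hle
  have hcritical : frobSq (S.costGradient X₀ K) = 0 :=
    DFunLike.congr_fun (hasFDerivAt_eq_zero_of_isLocalMin hlocal (hK.1.hasFDerivAt h hm hX))
      (S.costGradient X₀ K)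
  have hle := hK.1.mul_frobSq_gainResidual_le h hm hX
  rw [hcritical] at hle
  exact ⟨K, hK.1, frobSq_eq_zero.1
    ((nonpos_of_mul_nonpos_right hle (by positivity)).antisymm (frobSq_nonneg _))⟩

end Sublevel

section Riccati

theorem gainResidual_apply (K : MatTuple N k d) (V : MatTuple N d d) (i : Fin N) :
    S.gainResidual K V i = S.inputWeight V i * K i - (S.B i)ᵀ * S.E V i * S.A i := by
  simp only [gainResidual, inputWeight, closedLoop, Matrix.mul_sub, Matrix.add_mul,
    Matrix.mul_assoc]
  abel

theorem riccatiGain_apply (V : MatTuple N d d) (i : Fin N) :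
    S.riccatiGain V i = (S.inputWeight V i)⁻¹ * ((S.B i)ᵀ * S.E V i * S.A i) := by
  simp only [riccatiGain, inputWeight, Matrix.mul_assoc]

theorem IsRiccatiSolution.nonneg {P : MatTuple N d d} (hP : S.IsRiccatiSolution P) : 0 ≤ P :=
  fun i => (hP.1 i).posSemidef.nonneg

variable (h : S.IsRegular)
include h

theorem IsRegular.posDef_inputWeight {V : MatTuple N d d} (hV : 0 ≤ V) (i : Fin N) :
    (S.inputWeight V i).PosDef :=
  (h.posDef_R i).add_posSemidef
    (nonneg_iff_posSemidef.1 (transpose_mul_mul_nonneg (h.E_nonneg hV i) _))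

theorem IsRegular.gainResidual_eq_zero_iff {K : MatTuple N k d} {V : MatTuple N d d}
    (hV : 0 ≤ V) : S.gainResidual K V = 0 ↔ K = S.riccatiGain V := by
  rw [funext_iff, funext_iff]
  refine forall_congr' fun i => ?_
  have hdet := (isUnit_iff_isUnit_det _).1 (h.posDef_inputWeight hV i).isUnit
  rw [gainResidual_apply, riccatiGain_apply, Pi.zero_apply, sub_eq_zero]
  constructor
  · intro hK
    rw [← hK, nonsing_inv_mul_cancel_left _ _ hdet]
  · intro hK
    rw [hK, mul_nonsing_inv_cancel_left _ _ hdet]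

theorem IsRegular.runningCost_add_backward_riccatiGain {V : MatTuple N d d} (hV : 0 ≤ V)
    (i : Fin N) :
    (S.runningCost (S.riccatiGain V) + S.backward (S.riccatiGain V) V) i
      = S.Q i + (S.A i)ᵀ * S.E V i * S.A i
        - (S.A i)ᵀ * S.E V i * S.B i * (S.R i + (S.B i)ᵀ * S.E V i * S.B i)⁻¹
          * (S.B i)ᵀ * S.E V i * S.A i := by
  have hgain : (S.A i)ᵀ * S.E V i * S.B i * (S.R i + (S.B i)ᵀ * S.E V i * S.B i)⁻¹
      * (S.B i)ᵀ * S.E V i * S.A i = (S.A i)ᵀ * S.E V i * S.B i * S.riccatiGain V i := by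
    simp only [riccatiGain, Matrix.mul_assoc]
  have hzero : (S.riccatiGain V i)ᵀ * S.gainResidual (S.riccatiGain V) V i = 0 := by
    rw [(h.gainResidual_eq_zero_iff hV).2 rfl, Pi.zero_apply, Matrix.mul_zero]
  rw [hgain, ← sub_eq_zero, ← hzero, gainResidual_apply]
  generalize S.riccatiGain V = K
  simp only [Pi.add_apply, runningCost, backward_apply, closedLoop, inputWeight, transpose_sub,
    transpose_mul, Matrix.mul_sub, Matrix.sub_mul, Matrix.mul_add, Matrix.add_mul,
    Matrix.mul_assoc]
  abel

theorem Stable.isRiccatiSolution_value {K : MatTuple N k d} (hK : S.Stable K)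
    (hgain : K = S.riccatiGain (S.value K)) : S.IsRiccatiSolution (S.value K) := by
  refine ⟨fun i => ?_, fun i => ?_⟩
  · rw [← add_sub_cancel (S.Q i) (S.value K i)]
    exact (h.posDef_Q i).add_posSemidef
      (nonneg_iff_posSemidef.1 (sub_nonneg.2 (hK.Q_le_value h i)))
  · rw [← h.runningCost_add_backward_riccatiGain (h.value_nonneg K) i, ← hgain]
    exact congrFun (hK.value_eq h) i

theorem IsRiccatiSolution.eq_bellman {P : MatTuple N d d} (hP : S.IsRiccatiSolution P) :
    P = S.runningCost (S.riccatiGain P) + S.backward (S.riccatiGain P) P :=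
  funext fun i => (hP.2 i).trans (h.runningCost_add_backward_riccatiGain hP.nonneg i).symm

theorem IsRiccatiSolution.stable {P : MatTuple N d d} (hP : S.IsRiccatiSolution P) :
    S.Stable (S.riccatiGain P) :=
  .of_runningCost_add_backward_le h hP.nonneg (hP.eq_bellman h).ge

theorem IsRiccatiSolution.eq_value {P : MatTuple N d d} (hP : S.IsRiccatiSolution P) :
    P = S.value (S.riccatiGain P) :=
  (hP.stable h).eq_value h hP.nonneg (hP.eq_bellman h)

theorem IsRiccatiSolution.gainResidual_eq_zero {P : MatTuple N d d} (hP : S.IsRiccatiSolution P) :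
    S.gainResidual (S.riccatiGain P) (S.value (S.riccatiGain P)) = 0 := by
  rw [← hP.eq_value h]
  exact (h.gainResidual_eq_zero_iff hP.nonneg).2 rfl

end Riccati

section Optimal

variable (h : S.IsRegular) {K Ks : MatTuple N k d} (hK : S.Stable K) (hKs : S.Stable Ks)
  (hcritical : S.gainResidual Ks (S.value Ks) = 0)
include h hK hKs hcritical

theorem value_sub_value_of_gainResidual_eq_zero :
    S.value K - S.value Ks - S.backward K (S.value K - S.value Ks)
      = S.curvature (Ks - K) (S.value Ks) := by
  have hsub := hK.value_sub_value h hKs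
  have hzero : symProd (Ks - K) (0 : MatTuple N k d) = 0 := by
    ext1 i
    simp [symProd]
  rw [hcritical, hzero, zero_sub] at hsub
  rw [← neg_inj, ← hsub, ← neg_sub (S.value K), map_neg]
  abel

theorem value_le_value_of_gainResidual_eq_zero : S.value Ks ≤ S.value K := by
  refine hK.le_of_backward_sub_le h (h.value_nonneg Ks) (h.value_nonneg K) ?_
  rw [← sub_nonneg, value_sub_value_of_gainResidual_eq_zero h hK hKs hcritical]
  exact h.curvature_nonneg _ (h.value_nonneg Ks)

theorem mul_frobSq_sub_le_of_gainResidual_eq_zero {X₀ : MatTuple N d d} {m : ℝ} (hm : 0 < m)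
    (hX : m • 1 ≤ X₀) {r : ℝ} (hr : 0 ≤ r) (hrR : r • 1 ≤ S.R) :
    m * r * frobSq (K - Ks) ≤ S.quadCost X₀ K - S.quadCost X₀ Ks := by
  rw [quadCost, quadCost, ← map_sub, ← hK.pairing_totalCov h (nonneg_of_smul_one_le hm.le hX),
    value_sub_value_of_gainResidual_eq_zero h hK hKs hcritical, frobSq_sub_comm]
  exact mul_frobSq_le_pairing hm.le hr (hK.smul_one_le_totalCov h hm hX)
    (hrR.trans (h.R_le_inputWeight (h.value_nonneg Ks))) _

end Optimal

theorem IsRiccatiSolution.unique (h : S.IsRegular) {P P' : MatTuple N d d}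
    (hP : S.IsRiccatiSolution P) (hP' : S.IsRiccatiSolution P') : P = P' := by
  rw [hP.eq_value h, hP'.eq_value h]
  exact le_antisymm
    (value_le_value_of_gainResidual_eq_zero h (hP'.stable h) (hP.stable h)
      (hP.gainResidual_eq_zero h))
    (value_le_value_of_gainResidual_eq_zero h (hP.stable h) (hP'.stable h)
      (hP'.gainResidual_eq_zero h))

theorem symProd_sub_curvature_le (h : S.IsRegular) {V : MatTuple N d d} (hV : 0 ≤ V) {r : ℝ}
    (hr : 0 < r) (hrR : r • 1 ≤ S.R) (D M : MatTuple N k d) :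
    symProd D M - S.curvature D V ≤ r⁻¹ • fun i => (M i)ᵀ * M i := fun i => by
  have hyoung := young_of_nonneg (PosSemidef.one.nonneg : 0 ≤ (1 : Matrix (Fin k) (Fin k) ℝ))
    (D i) (M i) hr
  have hcurvature := transpose_mul_mul_mono ((hrR.trans (h.R_le_inputWeight hV)) i) (D i)
  simp only [Matrix.mul_one, Pi.smul_apply, Pi.one_apply, Matrix.mul_smul,
    Matrix.smul_mul] at hyoung hcurvature
  exact (sub_le_sub hyoung hcurvature).trans_eq (add_sub_cancel_left _ _)

theorem Stable.quadCost_sub_le_frobSq_costGradient (h : S.IsRegular) {X₀ : MatTuple N d d} {m : ℝ}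
    (hm : 0 < m) (hX : m • 1 ≤ X₀) {K Ks : MatTuple N k d} (hK : S.Stable K) (hKs : S.Stable Ks)
    {r χ : ℝ} (hr : 0 < r) (hrR : r • 1 ≤ S.R) (hχ : S.totalCov X₀ Ks ≤ χ • 1) (hχ0 : 0 ≤ χ) :
    4 * m ^ 2 * r * (S.quadCost X₀ K - S.quadCost X₀ Ks)
      ≤ χ * frobSq (S.costGradient X₀ K) := by
  have hX0 := nonneg_of_smul_one_le hm.le hX
  set M := S.gainResidual K (S.value K)
  have hgap : S.quadCost X₀ K - S.quadCost X₀ Ks ≤ r⁻¹ * (χ * frobSq M) := by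
    rw [hKs.quadCost_sub_quadCost h hK hX0]
    refine (pairing_mono_right (h.totalCov_nonneg hX0 Ks)
      (symProd_sub_curvature_le h (h.value_nonneg K) hr hrR _ _)).trans ?_
    rw [map_smul, smul_eq_mul]
    gcongr
    exact pairing_transpose_mul_self_le hχ M
  calc 4 * m ^ 2 * r * (S.quadCost X₀ K - S.quadCost X₀ Ks)
      ≤ 4 * m ^ 2 * r * (r⁻¹ * (χ * frobSq M)) := by gcongr
    _ = χ * (4 * m ^ 2 * frobSq M) := by field_simp
    _ ≤ χ * frobSq (S.costGradient X₀ K) := by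
      gcongr
      exact hK.mul_frobSq_gainResidual_le h hm hX

section Descent

theorem quadCost_sub_smul_le {X₀ : MatTuple N d d} {K G : MatTuple N k d} {ℓ t : ℝ}
    (ht : 0 ≤ t) (htℓ : t * ℓ ≤ 1)
    (hsmooth : S.quadCost X₀ (K - t • G) - S.quadCost X₀ K - frobInner G (K - t • G - K)
      ≤ ℓ / 2 * frobSq (K - t • G - K)) :
    S.quadCost X₀ (K - t • G) ≤ S.quadCost X₀ K - t / 2 * frobSq G := by
  have hquadratic : t * ℓ * (t * frobSq G) ≤ 1 * (t * frobSq G) :=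
    mul_le_mul_of_nonneg_right htℓ (mul_nonneg ht (frobSq_nonneg G))
  rw [sub_sub_cancel_left, map_neg, map_smul, frobInner_self, frobSq_neg, frobSq_smul,
    smul_eq_mul] at hsmooth
  linarith

variable (h : S.IsRegular) {X₀ : MatTuple N d d} {m : ℝ} (hm : 0 < m) (hX : m • 1 ≤ X₀)
  {K : MatTuple N k d} (hK : S.Stable K)
include h hm hX hK

theorem Stable.eventually_sub_smul_costGradient_mem_sublevel :
    ∀ᶠ t in 𝓝[>] (0 : ℝ),
      K - t • S.costGradient X₀ K ∈ S.sublevel X₀ (S.quadCost X₀ K) := by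
  obtain ⟨c, -, hev⟩ := hK.exists_eventually_abs_le h hm hX
  have hline : Tendsto (fun t : ℝ => K - t • S.costGradient X₀ K) (𝓝[>] 0) (𝓝 K) :=
    tendsto_nhdsWithin_of_tendsto_nhds
      (Continuous.tendsto' (by fun_prop) 0 K (by rw [zero_smul, sub_zero]))
  have hsmall : ∀ᶠ t in 𝓝[>] (0 : ℝ), t * (2 * c) < 1 :=
    nhdsWithin_le_nhds <| (continuous_mul_const (2 * c)).continuousAt.eventually_lt
      continuousAt_const (by rw [zero_mul]; exact one_pos)
  filter_upwards [hline.eventually hev, hsmall, self_mem_nhdsWithin] with t hquad ht (hpos : 0 < t)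
  have hstep := quadCost_sub_smul_le hpos.le ht.le
    ((le_abs_self _).trans (hquad.2.trans_eq (by ring)))
  exact ⟨hquad.1, hstep.trans (sub_le_self _ (mul_nonneg (by positivity) (frobSq_nonneg _)))⟩

theorem Stable.sub_smul_costGradient_mem_sublevel {ℓ η : ℝ} (hη : 0 < η) (hηℓ : η * ℓ ≤ 1)
    (hsmooth : ∀ K' ∈ S.sublevel X₀ (S.quadCost X₀ K),
      S.quadCost X₀ K' - S.quadCost X₀ K - frobInner (S.costGradient X₀ K) (K' - K)
        ≤ ℓ / 2 * frobSq (K' - K)) :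
    K - η • S.costGradient X₀ K
      ∈ S.sublevel X₀ (S.quadCost X₀ K - η / 2 * frobSq (S.costGradient X₀ K)) := by
  set G := S.costGradient X₀ K
  set s : Set ℝ := (fun t => K - t • G) ⁻¹' S.sublevel X₀ (S.quadCost X₀ K) with hs
  have hline : Continuous fun t : ℝ => K - t • G := by fun_prop
  have hstep (t : ℝ) (ht : t ∈ s) (ht0 : 0 ≤ t) (htη : t ≤ η) :
      S.quadCost X₀ (K - t • G) ≤ S.quadCost X₀ K - t / 2 * frobSq G := by
    refine quadCost_sub_smul_le ht0 ?_ (hsmooth _ ht)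
    rcases le_total ℓ 0 with hℓ | hℓ
    · exact (mul_nonpos_of_nonneg_of_nonpos ht0 hℓ).trans zero_le_one
    · exact (mul_le_mul_of_nonneg_right htη hℓ).trans hηℓ
  rcases (frobSq_nonneg G).eq_or_lt with hzero | hpos
  · rw [← hzero, frobSq_eq_zero.1 hzero.symm, smul_zero, sub_zero, mul_zero, sub_zero]
    exact ⟨hK, le_rfl⟩
  -- The segment cannot leave the sublevel set before `t = η`: as long as it stays inside, the cost
  -- at `t > 0` is strictly smaller than at `K`.
  have hsub : Set.Icc 0 η ⊆ s := by
    refine IsClosed.Icc_subset_of_forall_exists_gt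
      (((isClosed_sublevel h hm hX _).preimage hline).inter isClosed_Icc) ?_ ?_
    · rw [hs, Set.mem_preimage, zero_smul, sub_zero]
      exact ⟨hK, le_rfl⟩
    rintro t ⟨hts, ht0, htη⟩ y hy
    have hev : ∀ᶠ t' in 𝓝[>] t, t' ∈ s := by
      rcases ht0.eq_or_lt with rfl | htpos
      · exact hK.eventually_sub_smul_costGradient_mem_sublevel h hm hX
      · have hlt : S.quadCost X₀ (K - t • G) < S.quadCost X₀ K :=
          (hstep t hts ht0 htη.le).trans_lt (sub_lt_self _ (by positivity))
        exact nhdsWithin_le_nhds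
          (hline.continuousAt.eventually (hts.1.eventually_mem_sublevel h hm hX hlt))
    obtain ⟨t', ht', hmem⟩ := (hev.and (Ioc_mem_nhdsGT hy)).exists
    exact ⟨t', ht', hmem⟩
  have hmem := hsub (Set.right_mem_Icc.2 hη.le)
  exact ⟨hmem.1, hstep η hmem hη.le le_rfl⟩

end Descent

section GradientDescent

variable (S) in
/-- A run of gradient descent on `quadCost X₀` with a step size admissible for the smoothness of
the cost on the sublevel set of the initial gain.  The step is prescribed at stable gains only,
since the cost of a Markov chain is differentiable there. -/
structure IsGradientDescent (X₀ : MatTuple N d d) (η : ℝ) (K : ℕ → MatTuple N k d) : Prop where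
  step_pos : 0 < η
  stable_zero : S.Stable (K 0)
  succ_eq : ∀ n, S.Stable (K n) → K (n + 1) = K n - η • S.costGradient X₀ (K n)
  smooth : ∀ K₁ ∈ S.sublevel X₀ (S.quadCost X₀ (K 0)), ∀ K₂ ∈ S.sublevel X₀ (S.quadCost X₀ (K 0)),
    S.quadCost X₀ K₂ - S.quadCost X₀ K₁ - frobInner (S.costGradient X₀ K₁) (K₂ - K₁)
      ≤ η⁻¹ / 2 * frobSq (K₂ - K₁)

variable (h : S.IsRegular) {X₀ : MatTuple N d d} {m : ℝ} (hm : 0 < m) (hX : m • 1 ≤ X₀) {η : ℝ}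
  {K : ℕ → MatTuple N k d} (hgd : S.IsGradientDescent X₀ η K)
include h hm hX hgd

namespace IsGradientDescent

theorem succ_mem_sublevel {n : ℕ} (hn : K n ∈ S.sublevel X₀ (S.quadCost X₀ (K 0))) :
    K (n + 1)
      ∈ S.sublevel X₀ (S.quadCost X₀ (K n) - η / 2 * frobSq (S.costGradient X₀ (K n))) := by
  rw [hgd.succ_eq n hn.1]
  exact hn.1.sub_smul_costGradient_mem_sublevel h hm hX hgd.step_pos
    (mul_inv_cancel₀ hgd.step_pos.ne').le fun K' hK' =>
      hgd.smooth _ hn _ ⟨hK'.1, hK'.2.trans hn.2⟩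

theorem mem_sublevel (n : ℕ) : K n ∈ S.sublevel X₀ (S.quadCost X₀ (K 0)) := by
  induction n with
  | zero => exact ⟨hgd.stable_zero, le_rfl⟩
  | succ n ih =>
    have hdecrease := hgd.succ_mem_sublevel h hm hX ih
    refine ⟨hdecrease.1, hdecrease.2.trans ((sub_le_self _ ?_).trans ih.2)⟩
    exact mul_nonneg (half_pos hgd.step_pos).le (frobSq_nonneg _)

variable {Ks : MatTuple N k d} (hKs : S.Stable Ks)
  (hcritical : S.gainResidual Ks (S.value Ks) = 0) {r : ℝ} (hr : 0 < r) (hrR : r • 1 ≤ S.R)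
  {χ : ℝ} (hχ : S.totalCov X₀ Ks ≤ χ • 1) (hχ0 : 0 < χ)
include hKs hr hrR hχ hχ0

theorem quadCost_succ_sub_le (n : ℕ) :
    S.quadCost X₀ (K (n + 1)) - S.quadCost X₀ Ks
      ≤ (1 - 2 * m ^ 2 * r / χ * η) * (S.quadCost X₀ (K n) - S.quadCost X₀ Ks) := by
  have hn := hgd.mem_sublevel h hm hX n
  have hdecrease := (hgd.succ_mem_sublevel h hm hX hn).2
  have hdominate : 4 * m ^ 2 * r * (S.quadCost X₀ (K n) - S.quadCost X₀ Ks) / χ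
      ≤ frobSq (S.costGradient X₀ (K n)) := by
    rw [div_le_iff₀' hχ0]
    exact hn.1.quadCost_sub_le_frobSq_costGradient h hm hX hKs hr hrR hχ hχ0.le
  have hscaled := mul_le_mul_of_nonneg_left hdominate (half_pos hgd.step_pos).le
  have hrate : η / 2 * (4 * m ^ 2 * r * (S.quadCost X₀ (K n) - S.quadCost X₀ Ks) / χ)
      = 2 * m ^ 2 * r / χ * η * (S.quadCost X₀ (K n) - S.quadCost X₀ Ks) := by ring
  linarith

include hcritical

theorem quadCost_sub_le_pow_mul (n : ℕ) :
    S.quadCost X₀ (K n) - S.quadCost X₀ Ks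
      ≤ (1 - 2 * m ^ 2 * r / χ * η) ^ n * (S.quadCost X₀ (K 0) - S.quadCost X₀ Ks) :=
  le_pow_mul_of_le_mul
    (fun n => sub_nonneg.2 (pairing_mono_right (nonneg_of_smul_one_le hm.le hX)
      (value_le_value_of_gainResidual_eq_zero h (hgd.mem_sublevel h hm hX n).1 hKs hcritical)))
    (hgd.quadCost_succ_sub_le h hm hX hKs hr hrR hχ hχ0) n

omit hr hrR hχ hχ0 in
theorem tendsto : Tendsto K atTop (𝓝 Ks) := by
  have hX0 := nonneg_of_smul_one_le hm.le hX
  obtain ⟨r, hr, hrR⟩ := h.exists_smul_one_le_R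
  have hχ : S.totalCov X₀ Ks ≤ (maxNorm (S.totalCov X₀ Ks) + 1) • 1 :=
    (le_maxNorm_smul_one fun i => transpose_eq_of_nonneg (h.totalCov_nonneg hX0 Ks i)).trans
      (smul_le_smul_of_nonneg_right (le_add_of_nonneg_right zero_le_one) one_nonneg)
  have hχ0 := add_pos_of_nonneg_of_pos (maxNorm_nonneg (S.totalCov X₀ Ks)) one_pos
  have hmr : 0 < m * r := mul_pos hm hr
  have hgap : ∀ n, m * r * frobSq (K n - Ks) ≤ S.quadCost X₀ (K n) - S.quadCost X₀ Ks := fun n =>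
    mul_frobSq_sub_le_of_gainResidual_eq_zero h (hgd.mem_sublevel h hm hX n).1 hKs hcritical hm hX
      hr.le hrR
  have hrate : 1 - 2 * m ^ 2 * r / (maxNorm (S.totalCov X₀ Ks) + 1) * η < 1 := by
    have := hgd.step_pos
    exact sub_lt_self _ (by positivity)
  have hlim := tendsto_zero_of_le_mul hrate
    (fun n => (mul_nonneg hmr.le (frobSq_nonneg _)).trans (hgap n))
    (hgd.quadCost_succ_sub_le h hm hX hKs hr hrR hχ hχ0)
  refine tendsto_of_tendsto_frobSq_sub (squeeze_zero (fun n => frobSq_nonneg _)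
    (fun n => (le_div_iff₀' hmr).2 (hgap n)) ?_)
  simpa only [zero_div] using hlim.div_const (m * r)

end IsGradientDescent

end GradientDescent

section State

variable (K : MatTuple N k d) (s : ℕ → Fin N) (v : Fin d → ℝ) (t : ℕ)

theorem state_succ :
    S.state K s v (t + 1) = S.closedLoop K (s t) *ᵥ S.state K s v t := by
  rw [state, closedLoop, sub_mulVec, mulVec_neg, ← sub_eq_add_neg, mulVec_mulVec]

theorem dependsOn_state : DependsOn (fun s => S.state K s v t) (Set.Iio t) := by
  induction t with
  | zero => exact fun _ _ _ => rfl
  | succ t ih =>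
    intro s s' hs
    simp only [state_succ, hs t (Nat.lt_succ_self t),
      ih fun r hr => hs r (Nat.lt_succ_of_lt hr)]

theorem continuous_state : Continuous fun v => S.state K s v t := by
  induction t with
  | zero => exact continuous_id
  | succ t ih =>
    simp only [state_succ]
    fun_prop

theorem stageCost_eq :
    S.stageCost K s v t = S.state K s v t ⬝ᵥ (S.runningCost K (s t) *ᵥ S.state K s v t) := by
  rw [stageCost, control, runningCost, add_mulVec, dotProduct_add, mulVec_neg, neg_dotProduct,
    dotProduct_neg, neg_neg, ← mulVec_mulVec, ← mulVec_mulVec, dotProduct_mulVec _ (K (s t))ᵀ,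
    vecMul_transpose]

end State

section Moments

variable {W : Type*} [MeasurableSpace W] {ν : Measure W} {y : W → Fin d → ℝ} {ω : ℕ → W → Fin N}

theorem memLp_state (hω : ∀ t, Measurable (ω t)) (hy : MemLp y 2 ν) (K : MatTuple N k d) (t : ℕ) :
    MemLp (fun w => S.state K (fun r => ω r w) (y w) t) 2 ν := by
  induction t with
  | zero => exact hy
  | succ t ih =>
    have hsplit : (fun w => S.state K (fun r => ω r w) (y w) (t + 1)) = fun w =>
        ∑ i, {w | ω t w = i}.indicator
          (fun w => S.closedLoop K i *ᵥ S.state K (fun r => ω r w) (y w) t) w := by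
      ext1 w
      simp [Set.indicator_apply, state_succ]
    rw [hsplit]
    exact memLp_finsetSum _ fun i _ =>
      (memLp_mulVec ih _).indicator (hω t (measurableSet_singleton i))

theorem secondMoment_state_eq_sum_modeCov (hω : ∀ t, Measurable (ω t)) (hy : MemLp y 2 ν)
    (K : MatTuple N k d) (t : ℕ) :
    secondMoment ν (fun w => S.state K (fun r => ω r w) (y w) t) = ∑ i, S.modeCov ν y ω K t i :=
  secondMoment_eq_sum_restrict_fiber (hω t) (memLp_state hω hy K t)

section StageCost

variable (hω : ∀ t, Measurable (ω t)) (hy : MemLp y 2 ν) (K : MatTuple N k d) (t : ℕ)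
include hω hy

theorem integrableOn_stageCost (i : Fin N) :
    IntegrableOn (fun w => S.stageCost K (fun r => ω r w) (y w) t) {w | ω t w = i} ν := by
  have hmeas : MeasurableSet {w | ω t w = i} := hω t (measurableSet_singleton i)
  refine (integrable_dotProduct_mulVec ((memLp_state (S := S) hω hy K t).restrict _)
    (S.runningCost K i)).congr ?_
  filter_upwards [ae_restrict_mem hmeas] with w (hw : ω t w = i)
  rw [stageCost_eq, hw]

theorem integrable_stageCost :
    Integrable (fun w => S.stageCost K (fun r => ω r w) (y w) t) ν := by
  have hcover : ⋃ i, {w | ω t w = i} = Set.univ := by ext w; simp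
  rw [← integrableOn_univ, ← hcover]
  exact integrableOn_finite_iUnion.2 fun i => integrableOn_stageCost hω hy K t i

theorem integral_stageCost :
    ∫ w, S.stageCost K (fun r => ω r w) (y w) t ∂ν
      = pairing (S.modeCov ν y ω K t) (S.runningCost K) := by
  rw [integral_eq_sum_setIntegral_fiber (hω t) (integrable_stageCost hω hy K t), pairing_apply]
  refine Finset.sum_congr rfl fun i _ => ?_
  rw [modeCov, ← integral_dotProduct_mulVec ((memLp_state (S := S) hω hy K t).restrict _)]
  refine setIntegral_congr_fun (hω t (measurableSet_singleton i)) fun w (hw : ω t w = i) => ?_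
  simp only [stageCost_eq, hw]

end StageCost

variable (hω : IsMarkovIndep S.p ν y ω) (K : MatTuple N k d)
include hω

theorem modeCov_zero :
    S.modeCov ν y ω K 0 = fun i => ν.real {w | ω 0 w = i} • secondMoment ν y := by
  ext i a b
  exact hω.setIntegral_init (g := fun v => v a * v b) (F := {s | s 0 = i}) (by fun_prop)
    ((measurable_pi_apply 0 : Measurable fun s : ℕ → Fin N => s 0) (measurableSet_singleton i))

variable (hy : MemLp y 2 ν) (t : ℕ)
include hy

theorem modeCov_succ : S.modeCov ν y ω K (t + 1) = S.forward K (S.modeCov ν y ω K t) := by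
  have hL2 := memLp_state (S := S) hω.measurable_mode hy K
  have hstep (i : Fin N) :
      S.closedLoop K i * S.modeCov ν y ω K t i * (S.closedLoop K i)ᵀ
        = secondMoment (ν.restrict {w | ω t w = i})
          fun w => S.state K (fun r => ω r w) (y w) (t + 1) := by
    rw [modeCov, ← secondMoment_mulVec ((hL2 t).restrict _)]
    ext a b
    refine setIntegral_congr_fun (hω.measurable_mode t (measurableSet_singleton i))
      fun w (hw : ω t w = i) => ?_
    simp only [state_succ, hw]
  ext j a b
  simp only [forward_apply, hstep, Matrix.sum_apply, Matrix.smul_apply, smul_eq_mul]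
  refine hω.setIntegral_succ
    (f := fun v s => S.state K s v (t + 1) a * S.state K s v (t + 1) b)
    (fun v s s' hs => ?_) (fun s => ?_) (integrable_apply_mul_apply (hL2 (t + 1)) a b) j
  · simp only [dependsOn_state K v (t + 1) fun r hr => hs r (Nat.le_of_lt_succ hr)]
  · have := continuous_state (S := S) K s (t + 1)
    exact Continuous.measurable (by fun_prop)

theorem modeCov_eq_forward_pow :
    S.modeCov ν y ω K t
      = (S.forward K ^ t) fun i => ν.real {w | ω 0 w = i} • secondMoment ν y := by
  induction t with
  | zero => rw [modeCov_zero hω, pow_zero, Module.End.one_apply]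
  | succ t ih => rw [modeCov_succ hω K hy, ih, pow_succ', Module.End.mul_apply]

end Moments

section Realization

theorem Stable.of_backward_pow_le (h : S.IsRegular) {K : MatTuple N k d} {t : ℕ}
    (ht : (S.backward K ^ t) 1 ≤ (2⁻¹ : ℝ) • 1) : S.Stable K := by
  refine Stable.of_add_backward_le h (P := ∑ r ∈ Finset.range t, (S.backward K ^ r) 1)
    (Finset.sum_nonneg fun r _ => h.backward_pow_nonneg K one_nonneg r)
    (by norm_num : (0 : ℝ) < 2⁻¹) le_rfl ?_
  have htelescope : 1 + S.backward K (∑ r ∈ Finset.range t, (S.backward K ^ r) 1)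
      = ∑ r ∈ Finset.range t, (S.backward K ^ r) 1 + (S.backward K ^ t) 1 := by
    rw [← Finset.sum_range_succ, Finset.sum_range_succ', map_sum, add_comm]
    simp only [pow_succ', Module.End.mul_apply, pow_zero, Module.End.one_apply]
  calc (2⁻¹ : ℝ) • 1 + S.backward K (∑ r ∈ Finset.range t, (S.backward K ^ r) 1)
      = ∑ r ∈ Finset.range t, (S.backward K ^ r) 1
          + ((S.backward K ^ t) 1 - (2⁻¹ : ℝ) • 1) := by
        rw [eq_sub_of_add_eq' htelescope]
        module
    _ ≤ ∑ r ∈ Finset.range t, (S.backward K ^ r) 1 :=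
        add_le_of_nonpos_right (sub_nonpos.2 ht)

variable {W : Type*} [MeasurableSpace W] {Pr : Measure W} {x0 : W → Fin d → ℝ}
  {ω : ℕ → W → Fin N}

variable (S Pr x0) in
/-- The mode-wise second moments `π i • 𝔼[x₀ x₀ᵀ]` of the initial state. -/
def initialCov : MatTuple N d d := fun i => S.init i • secondMoment Pr x0

namespace IsRealization

variable (hreal : S.IsRealization Pr x0 ω)
include hreal

theorem isMarkovIndep : IsMarkovIndep S.p Pr x0 ω where
  aemeasurable_init := hreal.measurable_x0.aemeasurable
  measurable_mode := hreal.measurable_mode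
  markov := hreal.markov
  indep := hreal.indep

theorem modeCov_eq (K : MatTuple N k d) (t : ℕ) :
    S.modeCov Pr x0 ω K t = (S.forward K ^ t) (S.initialCov Pr x0) := by
  rw [modeCov_eq_forward_pow hreal.isMarkovIndep K hreal.memLp_x0]
  simp only [hreal.init_law]
  rfl

theorem sumCov_eq (K : MatTuple N k d) :
    S.sumCov Pr x0 ω K = S.totalCov (S.initialCov Pr x0) K := by
  simp only [sumCov, totalCov, hreal.modeCov_eq]

theorem summable_modeCov (h : S.IsRegular) (hX : 0 ≤ S.initialCov Pr x0) {K : MatTuple N k d}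
    (hK : S.Stable K) : Summable (fun t => S.modeCov Pr x0 ω K t) := by
  simp only [hreal.modeCov_eq]
  exact hK.summable_forward h hX

theorem secondMoment_state_cond [IsFiniteMeasure Pr] (hpos : ∀ i, 0 < S.init i)
    (K : MatTuple N k d) (v : Fin d → ℝ) (i : Fin N) (t : ℕ) :
    secondMoment (Pr[|{w | ω 0 w = i}]) (fun w => S.state K (fun r => ω r w) v t)
      = ∑ j, (S.forward K ^ t) (Pi.single i (vecMulVec v v)) j := by
  have hmode : ∀ j, MeasurableSet {w | ω 0 w = j} := fun j =>
    hreal.measurable_mode 0 (measurableSet_singleton j)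
  have hne : Pr {w | ω 0 w = i} ≠ 0 := fun hzero =>
    (hpos i).ne' (by rw [← hreal.init_law, measureReal_def, hzero, ENNReal.toReal_zero])
  have := cond_isProbabilityMeasure hne
  have hinit : (fun j => (Pr[|{w | ω 0 w = i}]).real {w | ω 0 w = j} • vecMulVec v v)
      = Pi.single i (vecMulVec v v) := by
    ext1 j
    rcases eq_or_ne j i with rfl | hji
    · rw [Pi.single_eq_same, measureReal_def, cond_apply_self hne (measure_ne_top _ _),
        ENNReal.toReal_one, one_smul]
    · have hempty : {w | ω 0 w = i} ∩ {w | ω 0 w = j} = ∅ :=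
        Set.eq_empty_of_forall_notMem fun w hw => hji (hw.2.symm.trans hw.1)
      rw [Pi.single_eq_of_ne hji, measureReal_def, cond_apply (hmode i), hempty, measure_empty,
        mul_zero, ENNReal.toReal_zero, zero_smul]
  rw [secondMoment_state_eq_sum_modeCov hreal.measurable_mode (memLp_const v),
    modeCov_eq_forward_pow (hreal.isMarkovIndep.cond_init hne v) K (memLp_const v),
    secondMoment_const, hinit]

theorem mem_stabilizing_iff [IsFiniteMeasure Pr] (hpos : ∀ i, 0 < S.init i) (h : S.IsRegular)
    {K : MatTuple N k d} : K ∈ S.stabilizing Pr ω ↔ S.Stable K := by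
  simp only [stabilizing, Set.mem_ofPred_eq, hreal.secondMoment_state_cond hpos]
  refine ⟨fun hK => ?_, fun hK v i => ?_⟩
  · have hdiag : ∀ i a, Tendsto (fun t => (S.backward K ^ t) 1 i a a) atTop (𝓝 0) := fun i a => by
      have htrace := ((continuous_id.matrix_trace).tendsto 0).comp (hK (Pi.single a 1) i)
      rw [id_eq, trace_zero] at htrace
      refine htrace.congr fun t => ?_
      rw [Function.comp_apply, id_eq, trace_sum, ← pairing_one, pairing_forward_pow,
        pairing_single]
      simp
    have hsum : Tendsto (fun t => pairing ((S.backward K ^ t) 1) 1) atTop (𝓝 0) := by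
      simp only [pairing_one, trace, diag_apply]
      simpa using tendsto_finsetSum Finset.univ fun i _ =>
        tendsto_finsetSum Finset.univ fun a _ => hdiag i a
    obtain ⟨t, ht⟩ := (hsum.eventually_lt_const (by norm_num : (0 : ℝ) < 2⁻¹)).exists
    exact Stable.of_backward_pow_le h
      ((le_pairing_one_smul_one (h.backward_pow_nonneg K one_nonneg t)).trans
        (smul_le_smul_of_nonneg_right ht.le one_nonneg))
  · have hnonneg : 0 ≤ (Pi.single i (vecMulVec v v) : MatTuple N d d) :=
      Pi.single_nonneg.2 (by simpa using (posSemidef_vecMulVec_self_star v).nonneg)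
    have hlim := (hK.summable_forward h hnonneg).tendsto_atTop_zero
    simpa using tendsto_finsetSum Finset.univ fun j _ => tendsto_pi_nhds.1 hlim j

theorem extCost_eq (h : S.IsRegular) (hX : 0 ≤ S.initialCov Pr x0) {K : MatTuple N k d}
    (hK : S.Stable K) :
    S.extCost Pr x0 ω K = ENNReal.ofReal (S.quadCost (S.initialCov Pr x0) K) := by
  have hrun := h.runningCost_nonneg K
  have hint := integrable_stageCost (S := S) hreal.measurable_mode hreal.memLp_x0 K
  have hnonneg : ∀ t w, 0 ≤ S.stageCost K (fun r => ω r w) (x0 w) t := fun t w => by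
    rw [stageCost_eq]
    exact (nonneg_iff_dotProduct_mulVec.1 (hrun _)).2 _
  have hstage : ∀ t, ∫⁻ w, ENNReal.ofReal (S.stageCost K (fun r => ω r w) (x0 w) t) ∂Pr
      = ENNReal.ofReal (pairing (S.initialCov Pr x0) ((S.backward K ^ t) (S.runningCost K))) :=
    fun t => by
      rw [← ofReal_integral_eq_lintegral_ofReal (hint t) (ae_of_all _ (hnonneg t)),
        integral_stageCost hreal.measurable_mode hreal.memLp_x0, hreal.modeCov_eq,
        pairing_forward_pow]
  have hsum := (hK.summable_backward h hrun).hasSum.map (pairing (S.initialCov Pr x0))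
    (continuous_pairing_right _)
  rw [extCost, lintegral_tsum fun t => (hint t).aemeasurable.ennreal_ofReal]
  simp only [hstage]
  rw [← ENNReal.ofReal_tsum_of_nonneg
    (fun t => pairing_nonneg hX (h.backward_pow_nonneg K hrun t)) hsum.summable]
  exact congrArg _ hsum.tsum_eq

theorem extCost_le_of_gainResidual_eq_zero (h : S.IsRegular) (hX : 0 ≤ S.initialCov Pr x0)
    {Ks K : MatTuple N k d} (hKs : S.Stable Ks)
    (hcritical : S.gainResidual Ks (S.value Ks) = 0) (hK : S.Stable K) :
    S.extCost Pr x0 ω Ks ≤ S.extCost Pr x0 ω K := by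
  rw [hreal.extCost_eq h hX hKs, hreal.extCost_eq h hX hK]
  exact ENNReal.ofReal_le_ofReal
    (pairing_mono_right hX (value_le_value_of_gainResidual_eq_zero h hK hKs hcritical))

theorem cost_eq (h : S.IsRegular) (hX : 0 ≤ S.initialCov Pr x0) {K : MatTuple N k d}
    (hK : S.Stable K) : S.cost Pr x0 ω K = S.quadCost (S.initialCov Pr x0) K := by
  rw [cost, hreal.extCost_eq h hX hK, ENNReal.toReal_ofReal (h.quadCost_nonneg hX K)]

variable (h : S.IsRegular) {m : ℝ} (hm : 0 < m) (hX : m • 1 ≤ S.initialCov Pr x0)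
  {K : MatTuple N k d} (hK : S.Stable K)
include h hm hX hK

theorem hasFDerivAt_cost :
    HasFDerivAt (S.cost Pr x0 ω)
      (frobInner (S.costGradient (S.initialCov Pr x0) K)).toContinuousLinearMap K :=
  (hK.hasFDerivAt h hm hX).congr_of_eventuallyEq
    ((hK.eventually h).mono fun _ hK' => hreal.cost_eq h (nonneg_of_smul_one_le hm.le hX) hK'.1)

theorem gradCost_eq :
    S.gradCost Pr x0 ω K = S.costGradient (S.initialCov Pr x0) K := by
  ext i a b
  rw [gradCost, of_apply, (hreal.hasFDerivAt_cost h hm hX hK).fderiv]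
  exact frobInner_single _ i a b

end IsRealization

end Realization

section SmoothnessConstant

variable {W : Type*} [MeasurableSpace W] {Pr : Measure W} {x0 : W → Fin d → ℝ}

theorem mu_pos [Nonempty (Fin N)] (hd : 0 < d) (hpos : ∀ i, 0 < S.init i)
    (hcov : (secondMoment Pr x0).PosDef) : 0 < S.mu Pr x0 := by
  obtain ⟨i, hi⟩ := exists_eq_ciInf_of_finite (f := S.init)
  rw [mu, ← hi]
  exact mul_pos (hpos i) (sigmaMin_pos hd hcov)

theorem mu_smul_one_le_initialCov (hpos : ∀ i, 0 < S.init i)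
    (hcov : 0 ≤ secondMoment Pr x0) :
    S.mu Pr x0 • (1 : MatTuple N d d) ≤ S.initialCov Pr x0 := fun i => by
  refine le_trans ?_ (smul_le_smul_of_nonneg_left (sigmaMin_smul_one_le hcov) (hpos i).le)
  rw [smul_smul]
  exact smul_le_smul_of_nonneg_right
    (mul_le_mul_of_nonneg_right (ciInf_le (Set.finite_range _).bddBelow i)
      (LinearMap.singularValues_nonneg _ _)) (one_nonneg i)

theorem exists_pos_smul_one_le_initialCov [Nonempty (Fin N)] (hpos : ∀ i, 0 < S.init i)
    (hcov : (secondMoment Pr x0).PosDef) :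
    ∃ m : ℝ, 0 < m ∧ m • (1 : MatTuple N d d) ≤ S.initialCov Pr x0 :=
  exists_pos_smul_one_le fun i => hcov.smul (hpos i)

/-- In dimension zero the minimal singular value is `0`, so that `smoothConst` is `0` through
division by zero. -/
theorem pos_dim_of_smoothConst_pos {α : ℝ} (hpos : 0 < S.smoothConst Pr x0 α) :
    0 < d ∧ 0 < k := by
  refine ⟨Nat.pos_of_ne_zero ?_, Nat.pos_of_ne_zero ?_⟩
  · rintro rfl
    simp [smoothConst, lambdaMin, sigmaMin_of_zero_dim] at hpos
  · rintro rfl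
    simp [smoothConst, maxNorm, specNorm_of_zero_cols] at hpos

variable (h : S.IsRegular) (hd : 0 < d) (hpos : ∀ i, 0 < S.init i)
  (hcov : (secondMoment Pr x0).PosDef)
include h hd hpos hcov

theorem isBounded_mu :
    S.IsBounded (S.initialCov Pr x0) (S.mu Pr x0) (lambdaMin S.Q) (maxNorm S.R)
      (maxNorm S.B) where
  m_pos := have := h.nonempty; mu_pos hd hpos hcov
  q_pos := have := h.nonempty; lambdaMin_pos hd h.posDef_Q
  ρ_nonneg := maxNorm_nonneg _
  b_nonneg := maxNorm_nonneg _
  le_initial := mu_smul_one_le_initialCov hpos hcov.posSemidef.nonneg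
  le_Q := lambdaMin_smul_one_le h.Q_nonneg
  R_le := le_maxNorm_smul_one fun i => transpose_eq_of_nonneg (h.R_nonneg i)
  B_le := transpose_mul_self_le_maxNorm_sq S.B

theorem lambdaMin_mul_xi (α : ℝ) :
    lambdaMin S.Q * S.xi Pr x0 α
      = α / S.mu Pr x0 - lambdaMin S.Q
        + (maxNorm S.R + maxNorm S.B ^ 2 * (α / S.mu Pr x0)) := by
  have hq := (isBounded_mu h hd hpos hcov).q_pos
  have hm := (isBounded_mu h hd hpos hcov).m_pos
  rw [xi]
  field_simp
  ring

variable {α : ℝ} {K : MatTuple N k d} (hK : K ∈ S.sublevel (S.initialCov Pr x0) α)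
include hK

theorem xi_nonneg : 0 ≤ S.xi Pr x0 α := by
  have := h.nonempty
  have hbd := isBounded_mu h hd hpos hcov
  have hq : lambdaMin S.Q ≤ α / S.mu Pr x0 := le_of_smul_one_le_smul_one hd
    (hbd.le_Q.trans ((hK.1.Q_le_value h).trans
      (h.value_le_smul_one hbd.m_pos hbd.le_initial hK.2)))
  have hα := hbd.q_pos.le.trans hq
  refine nonneg_of_mul_nonneg_right ?_ hbd.q_pos
  rw [lambdaMin_mul_xi h hd hpos hcov]
  exact add_nonneg (sub_nonneg.2 hq)
    (add_nonneg hbd.ρ_nonneg (mul_nonneg (sq_nonneg _) hα))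

theorem quadCost_sub_sub_frobInner_le_smoothConst {K' : MatTuple N k d}
    (hK' : K' ∈ S.sublevel (S.initialCov Pr x0) α) :
    S.quadCost (S.initialCov Pr x0) K' - S.quadCost (S.initialCov Pr x0) K
        - frobInner (S.costGradient (S.initialCov Pr x0) K) (K' - K)
      ≤ S.smoothConst Pr x0 α / 2 * frobSq (K' - K) := by
  refine (le_abs_self _).trans (((isBounded_mu h hd hpos hcov).abs_quadCost_sub_sub_frobInner_le h
    (xi_nonneg h hd hpos hcov hK) (lambdaMin_mul_xi h hd hpos hcov α).ge hK hK').trans_eq ?_)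
  rw [smoothConst]
  ring

end SmoothnessConstant

namespace IsRealization

variable {W : Type*} [MeasurableSpace W] {Pr : Measure W} {x0 : W → Fin d → ℝ}
  {ω : ℕ → W → Fin N} (hreal : S.IsRealization Pr x0 ω) (h : S.IsRegular)
  (hpos : ∀ i, 0 < S.init i) (hcov : (secondMoment Pr x0).PosDef)
  {K0 : MatTuple N k d} (hK0 : S.Stable K0) {η : ℝ} (hη : 0 < η)
  (hηL : η ≤ 1 / S.smoothConst Pr x0 (S.cost Pr x0 ω K0))
include hreal h hpos hcov hK0 hη hηL

theorem isGradientDescent_gdIter :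
    S.IsGradientDescent (S.initialCov Pr x0) η (S.gdIter Pr x0 ω η K0) := by
  have hL : 0 < S.smoothConst Pr x0 (S.cost Pr x0 ω K0) := one_div_pos.1 (hη.trans_le hηL)
  have hd := (pos_dim_of_smoothConst_pos hL).1
  have hbd := isBounded_mu h hd hpos hcov
  refine ⟨hη, hK0, fun n hn => ?_, fun K₁ hK₁ K₂ hK₂ => ?_⟩
  · rw [gdIter, hreal.gradCost_eq h hbd.m_pos hbd.le_initial hn]
  · rw [gdIter, ← hreal.cost_eq h hbd.initial_nonneg hK0] at hK₁ hK₂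
    refine (quadCost_sub_sub_frobInner_le_smoothConst h hd hpos hcov hK₁ hK₂).trans ?_
    gcongr
    · exact frobSq_nonneg _
    · exact (le_inv_comm₀ hη hL).1 (hηL.trans_eq (one_div _))

theorem stable_gdIter (n : ℕ) : S.Stable (S.gdIter Pr x0 ω η K0 n) := by
  have hL : 0 < S.smoothConst Pr x0 (S.cost Pr x0 ω K0) := one_div_pos.1 (hη.trans_le hηL)
  have hbd := isBounded_mu h (pos_dim_of_smoothConst_pos hL).1 hpos hcov
  exact ((hreal.isGradientDescent_gdIter h hpos hcov hK0 hη hηL).mem_sublevel h hbd.m_pos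
    hbd.le_initial n).1

variable {Ks : MatTuple N k d} (hKs : S.Stable Ks)
  (hcritical : S.gainResidual Ks (S.value Ks) = 0)
include hKs hcritical

theorem cost_gdIter_sub_le_pow_mul (n : ℕ) :
    S.cost Pr x0 ω (S.gdIter Pr x0 ω η K0 n) - S.cost Pr x0 ω Ks
      ≤ (1 - 2 * S.mu Pr x0 ^ 2 * lambdaMin S.R / maxNorm (S.sumCov Pr x0 ω Ks) * η) ^ n
        * (S.cost Pr x0 ω K0 - S.cost Pr x0 ω Ks) := by
  have := h.nonempty
  have hL : 0 < S.smoothConst Pr x0 (S.cost Pr x0 ω K0) := one_div_pos.1 (hη.trans_le hηL)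
  obtain ⟨hd, hk⟩ := pos_dim_of_smoothConst_pos hL
  have hbd := isBounded_mu h hd hpos hcov
  have hX := hbd.initial_nonneg
  have hχ : S.totalCov (S.initialCov Pr x0) Ks
      ≤ maxNorm (S.totalCov (S.initialCov Pr x0) Ks) • 1 :=
    le_maxNorm_smul_one fun i => transpose_eq_of_nonneg (h.totalCov_nonneg hX Ks i)
  have hχ0 := hbd.m_pos.trans_le (le_of_smul_one_le_smul_one hd
    ((hKs.smul_one_le_totalCov h hbd.m_pos hbd.le_initial).trans hχ))
  rw [hreal.cost_eq h hX (hreal.stable_gdIter h hpos hcov hK0 hη hηL n), hreal.cost_eq h hX hK0,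
    hreal.cost_eq h hX hKs, hreal.sumCov_eq]
  exact (hreal.isGradientDescent_gdIter h hpos hcov hK0 hη hηL).quadCost_sub_le_pow_mul h
    hbd.m_pos hbd.le_initial hKs hcritical (lambdaMin_pos hk h.posDef_R)
    (lambdaMin_smul_one_le h.R_nonneg) hχ hχ0 n

theorem tendsto_gdIter : Tendsto (S.gdIter Pr x0 ω η K0) atTop (𝓝 Ks) := by
  have hL : 0 < S.smoothConst Pr x0 (S.cost Pr x0 ω K0) := one_div_pos.1 (hη.trans_le hηL)
  have hbd := isBounded_mu h (pos_dim_of_smoothConst_pos hL).1 hpos hcov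
  exact (hreal.isGradientDescent_gdIter h hpos hcov hK0 hη hηL).tendsto h hbd.m_pos hbd.le_initial
    hKs hcritical

end IsRealization

end MJLS

end

theorem mainTheorem1 {N d k : ℕ} (S : MJLS N d k)
    {W : Type*} [MeasurableSpace W] (Pr : Measure W) [IsProbabilityMeasure Pr]
    (x0 : W → Fin d → ℝ) (ω : ℕ → W → Fin N)
    (hp_nonneg : ∀ i j, 0 ≤ S.p i j) (hp_sum : ∀ i, ∑ j, S.p i j = 1)
    (hinit_pos : ∀ i, 0 < S.init i) (hinit_sum : ∑ i, S.init i = 1)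
    (hreal : S.IsRealization Pr x0 ω)
    (hcov : (secondMoment Pr x0).PosDef)
    (hQ : ∀ i, (S.Q i).PosDef) (hR : ∀ i, (S.R i).PosDef)
    (hstab : (S.stabilizing Pr ω).Nonempty) :
    ∃ (P : MatTuple N d d) (Kstar : MatTuple N k d),
      -- `Kstar` is the gain of the unique positive definite Riccati solution
      S.IsRiccatiSolution P ∧ (∀ P', S.IsRiccatiSolution P' → P' = P) ∧
      Kstar = S.riccatiGain P ∧
      -- it is stabilizing, a global minimizer, and the series defining `𝐗^{Kstar}` converges
      Kstar ∈ S.stabilizing Pr ω ∧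
      S.extCost Pr x0 ω Kstar ≠ ∞ ∧
      (∀ K ∈ S.stabilizing Pr ω, S.extCost Pr x0 ω Kstar ≤ S.extCost Pr x0 ω K) ∧
      Summable (fun t => S.modeCov Pr x0 ω Kstar t) ∧
      ∀ K0 ∈ S.stabilizing Pr ω, ∀ η : ℝ, 0 < η →
        η ≤ 1 / S.smoothConst Pr x0 (S.cost Pr x0 ω K0) →
        -- the iterates stay in `𝕂`, where the cost is finite and differentiable
        (∀ n, S.gdIter Pr x0 ω η K0 n ∈ S.stabilizing Pr ω ∧
          S.extCost Pr x0 ω (S.gdIter Pr x0 ω η K0 n) ≠ ∞ ∧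
          DifferentiableAt ℝ (S.cost Pr x0 ω) (S.gdIter Pr x0 ω η K0 n)) ∧
        -- linear convergence to the global minimum
        (∀ n, S.cost Pr x0 ω (S.gdIter Pr x0 ω η K0 n) - S.cost Pr x0 ω Kstar
          ≤ (1 - 2 * S.mu Pr x0 ^ 2 * lambdaMin S.R
                / maxNorm (S.sumCov Pr x0 ω Kstar) * η) ^ n
            * (S.cost Pr x0 ω K0 - S.cost Pr x0 ω Kstar)) ∧
        Tendsto (S.gdIter Pr x0 ω η K0) atTop (𝓝 Kstar) := by
  have hne : Nonempty (Fin N) := by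
    by_contra hempty
    rw [not_nonempty_iff] at hempty
    simp at hinit_sum
  have h : S.IsRegular := ⟨hne, hp_nonneg, hp_sum, hQ, hR⟩
  have hstable {K} : K ∈ S.stabilizing Pr ω ↔ S.Stable K := hreal.mem_stabilizing_iff hinit_pos h
  obtain ⟨m, hm, hX⟩ := MJLS.exists_pos_smul_one_le_initialCov hinit_pos hcov
  have hX0 := MatTuple.nonneg_of_smul_one_le hm.le hX
  have hfinite {K} (hK : S.Stable K) : S.extCost Pr x0 ω K ≠ ∞ :=
    hreal.extCost_eq h hX0 hK ▸ ENNReal.ofReal_ne_top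
  obtain ⟨Ks, hKs, hcritical⟩ :=
    MJLS.exists_stable_gainResidual_eq_zero h hm hX (hstab.imp fun _ => hstable.1)
  have hgain := (h.gainResidual_eq_zero_iff (h.value_nonneg Ks)).1 hcritical
  have hriccati := hKs.isRiccatiSolution_value h hgain
  refine ⟨S.value Ks, Ks, hriccati, fun P' hP' => hP'.unique h hriccati, hgain, hstable.2 hKs,
    hfinite hKs, fun K hK => ?_, ?_, fun K0 hK0 η hη hηL => ⟨fun n => ?_, ?_, ?_⟩⟩
  · exact hreal.extCost_le_of_gainResidual_eq_zero h hX0 hKs hcritical (hstable.1 hK)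
  · exact hreal.summable_modeCov h hX0 hKs
  · have hn := hreal.stable_gdIter h hinit_pos hcov (hstable.1 hK0) hη hηL n
    exact ⟨hstable.2 hn, hfinite hn, (hreal.hasFDerivAt_cost h hm hX hn).differentiableAt⟩
  · exact hreal.cost_gdIter_sub_le_pow_mul h hinit_pos hcov (hstable.1 hK0) hη hηL hKs hcritical
  · exact hreal.tendsto_gdIter h hinit_pos hcov (hstable.1 hK0) hη hηL hKs hcritical
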